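/- Let $\boldsymbol f=(f_1,\dots,f_m)\subset\mathbb{Q}[y_1,\dots,y_t][x_1,\dots,x_n]$ have total degrees (in $(y,x)$) at most $d$. Assume that $\langle \boldsymbol f\rangle$ is radical, that $\mathcal V=V(\boldsymbol f)\subset\mathbb{C}^{t+n}$ is equidimensional of dimension $t$, and that the projection $\pi:(y,x)\mapsto y$ restricted to $\mathcal V$ is dominant, i.e. the image of every irreducible component of $\mathcal V$ is Zariski dense in $\mathbb{C}^t$. Let $a\in\mathbb{Q}^n$ and let $(w_a,v_1,\dots,v_n)$ be a parametric geometric resolution of $\boldsymbol f$ for the linear form $u=\sum_i a_ix_i$, that is: - $w_a\in\mathbb{Q}[y][u]$ is square-free and has no non-constant factor in $\mathbb{Q}[y]$; - $v_1,\dots,v_n\in\mathbb{Q}(y)[u]$ and $w_a$ divides $\sum_i a_iv_i-u\,\partial w_a/\partial u$ in $\mathbb{Q}(y)[u]$; - there is a non-empty Zariski open set $\mathcal Y\subset\mathbb{C}^t$ such that every $\eta\in\mathcal Y$ cancels no denominator of the coefficients of the $v_i$ and satisfies $$V(\boldsymbol f(\eta,\cdot))=\left\{\left(\tfrac{v_1}{\partial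 w_a/\partial u}(\eta,\vartheta),\dots,\tfrac{v_n}{\partial w_a/\partial u}(\eta,\vartheta)\right)\;\middle|\;\vartheta\in\mathbb{C},\ w_a(\eta,\vartheta)=0,\ \tfrac{\partial w_a}{\partial u}(\eta,\vartheta)\neq0\right\}.$$ Let $\mathcal Y_a\subset\mathbb{C}^t$ be the Zariski open set where the leading coefficient of $w_a$ in $u$, the resultant of $w_a$ and $\partial w_a/\partial u$ with respect to $u$, and the (reduced) denominators of the coefficients of $v_1,\dots,v_n$ do not vanish. Then: 1. $\mathcal Y_a$ is non-empty, and for every $\eta\in\mathcal Y_a\cap\mathbb{R}^t$ the system $\boldsymbol f(\eta,\cdot)=0$ has finitely many solutions in $\mathbb{R}^n$, as many as $w_a(\eta,\cdot)$ has (distinct) real roots. 2. In $\mathbb{C}^{t+1}$ with coordinates $(y,u)$, $$V\Big(\big\langle f_1,\dots,f_m,\,u-\textstyle\sum_i a_ix_i\big\rangle\cap\mathbb{Q}[y][u]\Big)=V(w_a),$$ and this set is the Zariski closure of the image of $V(\langle f_1,\dots,f_m,u-\sum_i a_ix_i\rangle)\subset\mathbb{C}^{t+n+1}$ under $(y,x,u)\mapsto(y,u)$.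 3. The total degree of $w_a$ in $(y,u)$ is at most $d^n$. -/

import Mathlib

open Polynomial

noncomputable section

namespace ParamSystem

/-! ### Affine algebraic sets over the complex numbers -/

/-- The Zariski closure of a subset of affine space over `ℂ`. -/
def zariskiClosure {σ : Type*} (S : Set (σ → ℂ)) : Set (σ → ℂ) :=
  MvPolynomial.zeroLocus ℂ (MvPolynomial.vanishingIdeal ℂ S)

/-- Zariski open subsets of affine space: complements of zero loci of complex polynomials. -/
def IsZariskiOpen {σ : Type*} (Y : Set (σ → ℂ)) : Prop :=
  ∃ I : Ideal (MvPolynomial σ ℂ), Y = (MvPolynomial.zeroLocus ℂ I)ᶜ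

/-- Irreducible algebraic sets: Zariski closed sets with prime vanishing ideal. -/
def IsIrreducibleAlgebraic {σ : Type*} (Z : Set (σ → ℂ)) : Prop :=
  zariskiClosure Z = Z ∧ (MvPolynomial.vanishingIdeal ℂ Z).IsPrime

/-- `Z` is an irreducible component of `V`: a maximal irreducible algebraic subset of `V`. -/
def IsComponent {σ : Type*} (Z V : Set (σ → ℂ)) : Prop :=
  Maximal (fun W : Set (σ → ℂ) => IsIrreducibleAlgebraic W ∧ W ⊆ V) Z

/-- The dimension of an algebraic set: the Krull dimension of its coordinate ring. -/
def algDim {σ : Type*} (Z : Set (σ → ℂ)) : WithBot ℕ∞ :=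
  ringKrullDim (MvPolynomial σ ℂ ⧸ MvPolynomial.vanishingIdeal ℂ Z)

/-! ### Parametric systems

The parameters `y` are indexed by `Fin t`, the variables `x` by `Fin n`; polynomials in `(y, x)`
are indexed by `Fin t ⊕ Fin n`. Adding one more variable `u` is done with `Option`, where `none`
is the index of `u`. -/

variable {t n m : ℕ}

/-- The complex algebraic set defined by the system in the `(y, x)`-space. -/
def variety (f : Fin m → MvPolynomial (Fin t ⊕ Fin n) ℚ) : Set (Fin t ⊕ Fin n → ℂ) :=
  MvPolynomial.zeroLocus ℂ (Ideal.span (Set.range f))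

/-- The standing assumptions on `f`: the ideal is radical, the algebraic set is equi-dimensional
of dimension `t`, and the projection to the parameter space is dominant, which means that the
image of every irreducible component is Zariski dense. -/
structure AssumptionB (f : Fin m → MvPolynomial (Fin t ⊕ Fin n) ℚ) : Prop where
  radical : (Ideal.span (Set.range f)).IsRadical
  equidimensional : ∀ Z, IsComponent Z (variety f) → algDim Z = (t : WithBot ℕ∞)
  dominant : ∀ Z, IsComponent Z (variety f) →
    zariskiClosure ((fun (z : Fin t ⊕ Fin n → ℂ) (i : Fin t) => z (Sum.inl i)) '' Z) = Set.univ

/-- The solutions with coordinates in `K` of the specialized system `f(η, ·)`. -/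
def solutions (K : Type*) [Field K] [Algebra ℚ K]
    (f : Fin m → MvPolynomial (Fin t ⊕ Fin n) ℚ) (η : Fin t → K) : Set (Fin n → K) :=
  {x | ∀ j, MvPolynomial.aeval (Sum.elim η x) (f j) = 0}

/-- A polynomial in `(y, u)` seen as a univariate polynomial in `u` with coefficients in `ℚ[y]`. -/
def inU (w : MvPolynomial (Option (Fin t)) ℚ) : (MvPolynomial (Fin t) ℚ)[X] :=
  MvPolynomial.optionEquivLeft ℚ (Fin t) w

/-- The specialization at `y = η` of a polynomial in `u` with coefficients in `ℚ[y]`. -/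
def specialize {K : Type*} [Field K] [Algebra ℚ K] (η : Fin t → K)
    (p : (MvPolynomial (Fin t) ℚ)[X]) : K[X] :=
  p.map (MvPolynomial.aeval η : MvPolynomial (Fin t) ℚ →ₐ[ℚ] K).toRingHom

/-- The field `ℚ(y)`. -/
abbrev RatFun (t : ℕ) : Type := FractionRing (MvPolynomial (Fin t) ℚ)

/-- The (reduced) denominator of a rational function. -/
def denom (c : RatFun t) : MvPolynomial (Fin t) ℚ :=
  (IsFractionRing.den (MvPolynomial (Fin t) ℚ) c : MvPolynomial (Fin t) ℚ)

/-- The value at `η` of a rational function, meaningful where its reduced denominator does not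
vanish. -/
def ratEval (η : Fin t → ℂ) (c : RatFun t) : ℂ :=
  MvPolynomial.aeval η (IsFractionRing.num (MvPolynomial (Fin t) ℚ) c) /
    MvPolynomial.aeval η (denom c)

/-- The value at `(η, ϑ)` of a polynomial in `u` with coefficients in `ℚ(y)`. -/
def ratPolyEval (η : Fin t → ℂ) (ϑ : ℂ) (p : (RatFun t)[X]) : ℂ :=
  p.sum fun k c => ratEval η c * ϑ ^ k

/-- `η` does not cancel any denominator of the coefficients of `v₁, …, vₙ`. -/
def DenomsNonzero (v : Fin n → (RatFun t)[X]) (η : Fin t → ℂ) : Prop :=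
  ∀ i k, MvPolynomial.aeval η (denom ((v i).coeff k)) ≠ 0

/-- The points `(v₁ / w', …, vₙ / w')(η, ϑ)` with `w(η, ϑ) = 0` and `w'(η, ϑ) ≠ 0`, where `w'` is
the derivative of `w` with respect to `u`. -/
def parametrizedPoints (w : MvPolynomial (Option (Fin t)) ℚ) (v : Fin n → (RatFun t)[X])
    (η : Fin t → ℂ) : Set (Fin n → ℂ) :=
  {x | ∃ ϑ : ℂ, (specialize η (inU w)).eval ϑ = 0 ∧
    (specialize η (derivative (inU w))).eval ϑ ≠ 0 ∧
    ∀ i, x i = ratPolyEval η ϑ (v i) / (specialize η (derivative (inU w))).eval ϑ}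

/-- `(w, v₁, …, vₙ)` is a parametric geometric resolution of `f` with respect to the linear form
`u = a₁ x₁ + ⋯ + aₙ xₙ`; `w` is its eliminating polynomial. -/
structure IsParametricResolution (f : Fin m → MvPolynomial (Fin t ⊕ Fin n) ℚ) (a : Fin n → ℚ)
    (w : MvPolynomial (Option (Fin t)) ℚ) (v : Fin n → (RatFun t)[X]) : Prop where
  squarefree : Squarefree w
  /-- Normalization: `w` has no non-constant factor in `ℚ[y]`. -/
  primitive : (inU w).IsPrimitive
  /-- The relation `u = (∑ i, aᵢ vᵢ / w') mod w` in `ℚ(y)[u]`. -/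
  linearForm : (inU w).map (algebraMap (MvPolynomial (Fin t) ℚ) (RatFun t)) ∣
    (∑ i, C (algebraMap ℚ (RatFun t) (a i)) * v i) -
      X * (derivative (inU w)).map (algebraMap (MvPolynomial (Fin t) ℚ) (RatFun t))
  /-- The solutions of `f(η, ·)` are parametrized for all `η` in a non-empty Zariski open set. -/
  parametrizes : ∃ Y : Set (Fin t → ℂ), IsZariskiOpen Y ∧ Y.Nonempty ∧
    ∀ η ∈ Y, DenomsNonzero v η ∧ solutions ℂ f η = parametrizedPoints w v η

/-- The open set of parameters at which the leading coefficient of `w` in `u`, the resultant of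
`w` and `∂w/∂u` with respect to `u`, and the denominators of `v₁, …, vₙ` do not vanish. -/
def goodSet (w : MvPolynomial (Option (Fin t)) ℚ) (v : Fin n → (RatFun t)[X]) :
    Set (Fin t → ℂ) :=
  {η | MvPolynomial.aeval η (inU w).leadingCoeff ≠ 0 ∧
    MvPolynomial.aeval η (resultant (inU w) (derivative (inU w))) ≠ 0 ∧
    DenomsNonzero v η}

/-- The ideal `⟨f₁, …, fₘ, u - (a₁ x₁ + ⋯ + aₙ xₙ)⟩` of `ℚ[y, x, u]`. -/
def idealU (f : Fin m → MvPolynomial (Fin t ⊕ Fin n) ℚ) (a : Fin n → ℚ) :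
    Ideal (MvPolynomial (Option (Fin t ⊕ Fin n)) ℚ) :=
  Ideal.span (Set.range (fun j => MvPolynomial.rename some (f j)) ∪
    {MvPolynomial.X none - ∑ i, MvPolynomial.C (a i) * MvPolynomial.X (some (Sum.inr i))})

/-- The elimination ideal `⟨f₁, …, fₘ, u - (a₁ x₁ + ⋯ + aₙ xₙ)⟩ ∩ ℚ[y, u]`. -/
def elimIdeal (f : Fin m → MvPolynomial (Fin t ⊕ Fin n) ℚ) (a : Fin n → ℚ) :
    Ideal (MvPolynomial (Option (Fin t)) ℚ) :=
  (idealU f a).comap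
    (MvPolynomial.rename (Option.map Sum.inl) :
      MvPolynomial (Option (Fin t)) ℚ →ₐ[ℚ] MvPolynomial (Option (Fin t ⊕ Fin n)) ℚ)

/-- The projection `(y, x, u) ↦ (y, u)`. -/
def projU (z : Option (Fin t ⊕ Fin n) → ℂ) : Option (Fin t) → ℂ :=
  fun i => z (i.map Sum.inl)

end ParamSystem

end

/-!
Write `p` for `w` as a polynomial in `u` over `ℚ[y]`, and write the parametrization with integral
numerators as `xᵢ = Vᵢ / (E p')`.

*From generic to good parameters.* Three facts, gathered in `IsClearedResolution`, replace the
generic description of the fibres by one valid at all good `η`. First, `w(y, u(x))` and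
`E p'(y, u(x)) xᵢ - Vᵢ(y, u(x))` vanish at the solutions over a non-empty open set of parameters;
by dominance these are dense in the variety (`AssumptionB.aeval_eq_zero`), so by the
Nullstellensatz both families lie in the radical ideal `⟨f⟩`. Second, substitution of `Vᵢ / (E p')`
in `fⱼ` gives, up to a denominator, a multiple of `w`. This is an instance of
`map_dvd_of_forall_aeval_eq_zero`: a polynomial vanishing on the part of the hypersurface `w = 0`
over a Zariski dense set of good parameters is divisible by `w`, even over `ℂ`. Third, the linear
form takes the value `ϑ` at the point given by a root `ϑ`. Hence `u` is a bijection from the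
solutions over `η` to the roots of `p(η, ·)`, and it respects real points since all data are
rational. The same divisibility statement shows that `w = 0` lies in the Zariski closure of the
projection, while `w` itself lies in the elimination ideal.

*The degree bound.* The two families of members of `⟨f⟩` show that the Jacobian matrix of `f` with
respect to `x` has trivial kernel over good parameters
(`IsClearedResolution.eq_zero_of_derivAlong`). By Baire's theorem there are `n` linear combinations
`Gᵢ` of the `fⱼ` that are nondegenerate at all solutions over a countable Zariski dense set of
parameters. For all small `ε ≠ 0` outside a finite set, every polynomial of degree at most `N`
agrees on the zeros of the `Gᵢ + ε xᵢᵈ` with a combination of the `dⁿ` monomials `x^α`, `αᵢ < d`,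
without terms of degree above `N`. So multiplication by `u` is described there by a `dⁿ × dⁿ`
matrix over `ℂ[y]`, and its characteristic polynomial is an equation for `u` of total degree at
most `dⁿ` in `(y, u)` (`eventually_exists_charpoly`). Normalized, these equations have a nonzero
limit point as `ε → 0`. Since nondegenerate zeros persist under the perturbation, the limit
vanishes at the nondegenerate zeros of `G` (`exists_equation_of_nondegenerate`), hence is a
multiple of `w`.
-/

noncomputable section

namespace ParamSystem

/-! ### Polynomials over an extension of the coefficient field, and Gauss's lemma -/

/-- Cancellation of a factor `D` prime to `w` carries over to a free extension, by comparison of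
coordinates. -/
theorem algebraMap_dvd_of_dvd_mul_of_free {A B : Type*} [CommRing A] [CommRing B] [Algebra A B]
    [Module.Free A B] {w D : A} (hwD : ∀ h, w ∣ D * h → w ∣ h) {g : B}
    (hg : algebraMap A B w ∣ algebraMap A B D * g) : algebraMap A B w ∣ g := by
  obtain ⟨q, hq⟩ := hg
  let b := Module.Free.chooseBasis A B
  have hcoord : ∀ i, w ∣ b.repr g i := fun i => by
    refine hwD _ ⟨b.repr q i, ?_⟩
    rw [← Algebra.smul_def, ← Algebra.smul_def] at hq
    simpa using congrArg (fun z => b.repr z i) hq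
  rw [← b.linearCombination_repr g, Finsupp.linearCombination_apply, Finsupp.sum]
  refine Finset.dvd_sum fun i _ => ?_
  rw [Algebra.smul_def]
  exact Dvd.dvd.mul_right (_root_.map_dvd _ (hcoord i)) _

/-- Divisibility by `w` after multiplication with `D` descends from an extension of the field of
coefficients: the polynomials over `K` are a free module over the polynomials over `k`. -/
theorem map_dvd_of_dvd_map_mul {k K σ : Type*} [Field k] [Field K] [Algebra k K]
    {w D : MvPolynomial σ k} (hwD : ∀ h, w ∣ D * h → w ∣ h) {g : MvPolynomial σ K}
    (hg : MvPolynomial.map (algebraMap k K) w ∣ MvPolynomial.map (algebraMap k K) D * g) :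
    MvPolynomial.map (algebraMap k K) w ∣ g := by
  let : Algebra (MvPolynomial σ k) (MvPolynomial σ K) := MvPolynomial.algebraMvPolynomial
  have hb : IsBaseChange (MvPolynomial σ k)
      (IsScalarTower.toAlgHom k K (MvPolynomial σ K)).toLinearMap :=
    (inferInstance : Algebra.IsPushout k (MvPolynomial σ k) K (MvPolynomial σ K)).out
  have : Module.Free (MvPolynomial σ k) (MvPolynomial σ K) :=
    Module.Free.of_basis (hb.basis (Module.Free.chooseBasis k K))
  exact algebraMap_dvd_of_dvd_mul_of_free hwD hg

/-- Pseudo-division of `g` by `p`. -/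
theorem exists_pow_leadingCoeff_mul_eq {R : Type*} [CommRing R] [IsDomain R] (p : R[X])
    (hp : p ≠ 0) (g : R[X]) :
    ∃ (N : ℕ) (q r : R[X]), C (p.leadingCoeff ^ N) * g = q * p + r ∧ r.degree < p.degree := by
  induction hk : g.natDegree using Nat.strong_induction_on generalizing g with
  | _ k ih =>
    by_cases hlt : g.degree < p.degree
    · exact ⟨0, 0, g, by simp, hlt⟩
    have hle : p.natDegree ≤ g.natDegree := natDegree_le_natDegree (not_lt.mp hlt)
    have hg0 : g ≠ 0 := by
      rintro rfl
      exact hlt (by simpa using bot_lt_iff_ne_bot.2 (by simpa using hp))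
    let s : R[X] := C g.leadingCoeff * X ^ (g.natDegree - p.natDegree)
    let g' : R[X] := C p.leadingCoeff * g - s * p
    have hlc : p.leadingCoeff ≠ 0 := leadingCoeff_ne_zero.2 hp
    by_cases hg' : g' = 0
    · refine ⟨1, s, 0, ?_, ?_⟩
      · rw [pow_one, add_zero]; exact sub_eq_zero.1 hg'
      · simpa using bot_lt_iff_ne_bot.2 (by simpa using hp)
    by_cases hk0 : g.natDegree = 0
    · -- both polynomials are constant
      exfalso
      have hp0 : p.natDegree = 0 := by omega
      apply hg'
      obtain ⟨x, rfl⟩ := natDegree_eq_zero.1 hk0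
      obtain ⟨y, rfl⟩ := natDegree_eq_zero.1 hp0
      change C (leadingCoeff (C y)) * C x - C (leadingCoeff (C x)) * X ^ _ * C y = 0
      rw [natDegree_C, natDegree_C, leadingCoeff_C, leadingCoeff_C]
      simp only [Nat.sub_self, pow_zero, mul_one]
      ring
    have hdeg : g'.natDegree < g.natDegree := by
      have h1 : (C p.leadingCoeff * g).degree = g.degree := degree_C_mul hlc
      have h2 : (s * p).degree = g.degree := by
        rw [degree_mul, degree_C_mul_X_pow _ (leadingCoeff_ne_zero.2 hg0), degree_eq_natDegree hp,
          degree_eq_natDegree hg0, ← Nat.cast_add, Nat.sub_add_cancel hle]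
      have h3 : g'.degree < (C p.leadingCoeff * g).degree := by
        refine degree_sub_lt_left (h1.trans h2.symm) (by simp [hlc, hg0]) ?_
        rw [leadingCoeff_mul, leadingCoeff_mul, leadingCoeff_C, leadingCoeff_C_mul_X_pow, mul_comm]
      rw [h1] at h3
      exact natDegree_lt_natDegree hg' h3
    obtain ⟨N, q, r, hqr, hr⟩ := ih g'.natDegree (hk ▸ hdeg) g' rfl
    refine ⟨N + 1, q + C (p.leadingCoeff ^ N) * s, r, ?_, hr⟩
    have : C (p.leadingCoeff ^ (N + 1)) * g
        = C (p.leadingCoeff ^ N) * g' + C (p.leadingCoeff ^ N) * s * p := by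
      simp only [g', pow_succ, map_mul]; ring
    rw [this, hqr]; ring

theorem IsPrimitive.dvd_of_dvd_C_mul {R : Type*} [CommRing R] [IsDomain R] [NormalizedGCDMonoid R]
    {p : R[X]} (hp : p.IsPrimitive) {D : R} (hD : D ≠ 0) {h : R[X]} (hd : p ∣ C D * h) :
    p ∣ h := by
  refine hp.dvd_of_fraction_map_dvd_fraction_map (K := FractionRing R) ?_
  have := Polynomial.map_dvd (algebraMap R (FractionRing R)) hd
  rw [Polynomial.map_mul, map_C] at this
  refine (IsUnit.dvd_mul_left ?_).1 this
  exact isUnit_C.2 (IsUnit.mk0 _ (by simpa using hD))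

/-- A square factor over the fraction field has a primitive integral multiple, whose square divides
`p` by Gauss's lemma. -/
theorem IsPrimitive.squarefree_map {R : Type*} [CommRing R] [IsDomain R] [NormalizedGCDMonoid R]
    {p : R[X]} (hp : p.IsPrimitive) (hs : Squarefree p) :
    Squarefree (p.map (algebraMap R (FractionRing R))) := by
  intro x hx
  have hp0 : p.map (algebraMap R (FractionRing R)) ≠ 0 := by
    rw [Polynomial.map_ne_zero_iff (IsFractionRing.injective _ _)]; exact hp.ne_zero
  have hx0 : x ≠ 0 := by rintro rfl; exact hp0 (by simpa using hx)
  let y := IsLocalization.integerNormalization (nonZeroDivisors R) x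
  obtain ⟨b, hb, hby⟩ := IsLocalization.integerNormalization_spec (nonZeroDivisors R) x
  have hb0 : (algebraMap R (FractionRing R)) b ≠ 0 := by
    simpa using nonZeroDivisors.ne_zero hb
  have hy : y.map (algebraMap R (FractionRing R)) = C (algebraMap R _ b) * x := by
    rw [hby, Algebra.smul_def]; rfl
  have hy0 : y ≠ 0 := by
    intro h
    rw [h, Polynomial.map_zero] at hy
    exact (mul_ne_zero (by simpa using hb0) hx0) hy.symm
  have hc0 : y.content ≠ 0 := by rwa [Ne, content_eq_zero_iff]
  -- over the fraction field, `x` is associated to the primitive part of its integral multiple `y`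
  have hxy : x ∣ (y.primPart).map (algebraMap R (FractionRing R)) ∧
      (y.primPart).map (algebraMap R (FractionRing R)) ∣ x := by
    have h1 : C (algebraMap R (FractionRing R) y.content) *
        (y.primPart).map (algebraMap R (FractionRing R)) = C (algebraMap R _ b) * x := by
      rw [← hy]; conv_rhs => rw [y.eq_C_content_mul_primPart]
      simp
    have u1 : IsUnit (C (algebraMap R (FractionRing R) y.content)) :=
      isUnit_C.2 (IsUnit.mk0 _ (by simpa using hc0))
    have u2 : IsUnit (C (algebraMap R (FractionRing R) b)) :=
      isUnit_C.2 (IsUnit.mk0 _ hb0)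
    exact ⟨(u1.dvd_mul_left).1 (h1 ▸ Dvd.intro_left _ rfl),
      (u2.dvd_mul_left).1 (h1 ▸ Dvd.intro_left _ rfl)⟩
  have hpp : y.primPart * y.primPart ∣ p := by
    refine (y.isPrimitive_primPart.mul
      y.isPrimitive_primPart).dvd_of_fraction_map_dvd_fraction_map (K := FractionRing R) ?_
    rw [Polynomial.map_mul]
    exact (mul_dvd_mul hxy.2 hxy.2).trans hx
  exact isUnit_of_dvd_unit hxy.1 ((hs _ hpp).map (mapRingHom _))

/-! ### Evaluation at points, and clearing the denominators of a parametrization -/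

section

variable {t n m : ℕ} {K : Type*} [Field K] [Algebra ℚ K]

/-- The point `(y, u) = (η, ϑ)`. -/
def pointYU (η : Fin t → K) (ϑ : K) : Option (Fin t) → K := fun o => o.elim ϑ η

/-- The value at `x` of the linear form with coefficients `a`. -/
def linVal (a : Fin n → ℚ) (x : Fin n → K) : K := ∑ i, algebraMap ℚ K (a i) * x i

/-- The linear form with coefficients `a` as a polynomial in `(y, x)`. -/
def linForm (t : ℕ) (a : Fin n → ℚ) : MvPolynomial (Fin t ⊕ Fin n) ℚ :=
  ∑ i, MvPolynomial.C (a i) * MvPolynomial.X (Sum.inr i)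

/-- Substitution of the linear form `a` for `u`. -/
def substU (a : Fin n → ℚ) :
    (MvPolynomial (Fin t) ℚ)[X] →+* MvPolynomial (Fin t ⊕ Fin n) ℚ :=
  eval₂RingHom (MvPolynomial.rename Sum.inl :
    MvPolynomial (Fin t) ℚ →ₐ[ℚ] MvPolynomial (Fin t ⊕ Fin n) ℚ).toRingHom (linForm t a)

theorem eval_specialize_inU (η : Fin t → K) (ϑ : K) (w : MvPolynomial (Option (Fin t)) ℚ) :
    (specialize η (inU w)).eval ϑ = MvPolynomial.aeval (pointYU η ϑ) w := by
  induction w using MvPolynomial.induction_on with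
  | C r => simp [inU, specialize]
  | add p q hp hq =>
    simp only [inU, specialize] at hp hq
    simp only [inU, specialize, map_add, Polynomial.map_add, eval_add, hp, hq]
  | mul_X p o hp =>
    simp only [inU, specialize] at hp
    simp only [inU, specialize, map_mul, Polynomial.map_mul, eval_mul, hp]
    cases o <;> simp [pointYU]

theorem specialize_mul (η : Fin t → K) (p q : (MvPolynomial (Fin t) ℚ)[X]) :
    specialize η (p * q) = specialize η p * specialize η q := Polynomial.map_mul _

theorem specialize_C (η : Fin t → K) (c : MvPolynomial (Fin t) ℚ) :
    specialize η (C c) = C (MvPolynomial.aeval η c) := Polynomial.map_C _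

theorem aeval_linForm (η : Fin t → K) (x : Fin n → K) (a : Fin n → ℚ) :
    MvPolynomial.aeval (Sum.elim η x) (linForm t a) = linVal a x := by
  simp [linForm, linVal]

theorem aeval_substU (η : Fin t → K) (x : Fin n → K) (a : Fin n → ℚ)
    (p : (MvPolynomial (Fin t) ℚ)[X]) :
    MvPolynomial.aeval (Sum.elim η x) (substU a p) = (specialize η p).eval (linVal a x) := by
  induction p using Polynomial.induction_on' with
  | add p q hp hq => rw [map_add, map_add, hp, hq, specialize, specialize, specialize,
      Polynomial.map_add, eval_add]
  | monomial k c =>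
    simp [substU, specialize, aeval_linForm, MvPolynomial.aeval_rename, Function.comp_def]

theorem aeval_algebraMap_comp {L : Type*} [Field L] [Algebra ℚ L] (φ : K →ₐ[ℚ] L) {σ : Type*}
    (z : σ → K) (p : MvPolynomial σ ℚ) :
    MvPolynomial.aeval (fun i => φ (z i)) p = φ (MvPolynomial.aeval z p) :=
  (MvPolynomial.comp_aeval_apply _ φ _).symm

theorem denomsNonzero_iff (v : Fin n → (RatFun t)[X]) (η : Fin t → ℂ) :
    DenomsNonzero v η ↔
      MvPolynomial.aeval η (∏ i, ∏ k ∈ (v i).support, denom ((v i).coeff k)) ≠ 0 := by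
  simp only [map_prod, Finset.prod_ne_zero_iff, DenomsNonzero]
  refine ⟨fun h i _ k _ => h i k, fun h i k => ?_⟩
  -- outside the support the coefficient is `0`, whose reduced denominator is a unit
  by_cases hk : k ∈ (v i).support
  · exact h i (Finset.mem_univ _) k hk
  · rw [notMem_support_iff.1 hk]
    exact ((IsFractionRing.isUnit_den_zero (A := MvPolynomial (Fin t) ℚ) (K := RatFun t)).map
      (MvPolynomial.aeval η)).ne_zero

theorem denom_ne_zero (c : RatFun t) : denom c ≠ 0 :=
  nonZeroDivisors.ne_zero (IsFractionRing.den (MvPolynomial (Fin t) ℚ) c).2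

theorem algebraMap_num_eq (c : RatFun t) :
    algebraMap _ (RatFun t) (IsFractionRing.num (MvPolynomial (Fin t) ℚ) c) =
      c * algebraMap _ (RatFun t) (denom c) := by
  have h := IsFractionRing.mk'_num_den' (MvPolynomial (Fin t) ℚ) c
  have h0 : algebraMap _ (RatFun t) (denom c) ≠ 0 := by
    simpa using denom_ne_zero c
  exact (div_eq_iff h0).1 h

/-- Clearing denominators: `E` is the product of the denominators of the coefficients of `v`. -/
theorem exists_cleared (v : Fin n → (RatFun t)[X]) :
    ∃ (E : MvPolynomial (Fin t) ℚ) (V : Fin n → (MvPolynomial (Fin t) ℚ)[X]), E ≠ 0 ∧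
      (∀ η : Fin t → ℂ, DenomsNonzero v η ↔ MvPolynomial.aeval η E ≠ 0) ∧
      ∀ i, (V i).map (algebraMap _ (RatFun t)) = C (algebraMap _ (RatFun t) E) * v i := by
  refine ⟨∏ i, ∏ k ∈ (v i).support, denom ((v i).coeff k), ?_⟩
  set E := ∏ i, ∏ k ∈ (v i).support, denom ((v i).coeff k) with hE
  have hc : ∀ i k, ∃ c : MvPolynomial (Fin t) ℚ,
      algebraMap _ (RatFun t) c = algebraMap _ (RatFun t) E * (v i).coeff k := by
    intro i k
    by_cases hk : k ∈ (v i).support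
    · obtain ⟨e, he⟩ : denom ((v i).coeff k) ∣ E :=
        (Finset.dvd_prod_of_mem (fun k => denom ((v i).coeff k)) hk).trans
          (Finset.dvd_prod_of_mem (fun i => ∏ k ∈ (v i).support, denom ((v i).coeff k))
            (Finset.mem_univ i))
      refine ⟨e * IsFractionRing.num (MvPolynomial (Fin t) ℚ) ((v i).coeff k), ?_⟩
      rw [map_mul, algebraMap_num_eq, he, map_mul]
      ring
    · exact ⟨0, by rw [notMem_support_iff.1 hk]; simp⟩
  choose c hc using hc
  refine ⟨fun i => ∑ k ∈ (v i).support, monomial k (c i k), ?_, denomsNonzero_iff v, fun i => ?_⟩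
  · exact Finset.prod_ne_zero_iff.2 fun i _ => Finset.prod_ne_zero_iff.2 fun k _ => denom_ne_zero _
  · rw [Polynomial.map_sum]
    conv_rhs => rw [(v i).as_sum_support, Finset.mul_sum]
    refine Finset.sum_congr rfl fun k _ => ?_
    rw [map_monomial, hc, C_mul_monomial]

/-- Where no denominator vanishes, the value of `p` is the value of `V = E p` divided by that of
`E`. -/
theorem eval_specialize_cleared {E : MvPolynomial (Fin t) ℚ} (hE : E ≠ 0)
    {V : (MvPolynomial (Fin t) ℚ)[X]} {p : (RatFun t)[X]}
    (hV : V.map (algebraMap _ (RatFun t)) = C (algebraMap _ (RatFun t) E) * p) (η : Fin t → ℂ)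
    (hη : ∀ k, MvPolynomial.aeval η (denom (p.coeff k)) ≠ 0) (ϑ : ℂ) :
    (specialize η V).eval ϑ = MvPolynomial.aeval η E * ratPolyEval η ϑ p := by
  have hcoeff : ∀ k, algebraMap _ (RatFun t) (V.coeff k) =
      algebraMap _ (RatFun t) E * p.coeff k := fun k => by
    simpa using congrArg (fun q => q.coeff k) hV
  have hsupp : V.support = p.support := by
    ext k
    have h0 : algebraMap _ (RatFun t) E ≠ 0 := by simpa using hE
    rw [mem_support_iff, mem_support_iff, ← (map_ne_zero_iff (algebraMap _ (RatFun t))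
      (IsFractionRing.injective _ _)), hcoeff]
    simp [hE]
  have hval : ∀ k, MvPolynomial.aeval η (V.coeff k) =
      MvPolynomial.aeval η E * ratEval η (p.coeff k) := fun k => by
    have h1 : V.coeff k * denom (p.coeff k) =
        E * IsFractionRing.num (MvPolynomial (Fin t) ℚ) (p.coeff k) := by
      apply IsFractionRing.injective (MvPolynomial (Fin t) ℚ) (RatFun t)
      rw [map_mul, map_mul, algebraMap_num_eq, hcoeff]
      ring
    rw [ratEval, mul_div_assoc', eq_div_iff (hη k), ← map_mul, ← map_mul, h1]
  rw [specialize, eval_map, eval₂_eq_sum, Polynomial.sum, hsupp, ratPolyEval, Polynomial.sum,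
    Finset.mul_sum]
  refine Finset.sum_congr rfl fun k _ => ?_
  rw [← mul_assoc, ← hval]; rfl

end

/-! ### Good parameters and divisibility by the eliminating polynomial -/

section

variable {t n m : ℕ}

theorem optionEquivLeft_rename_some {k σ : Type*} [Field k] (c : MvPolynomial σ k) :
    MvPolynomial.optionEquivLeft k σ (MvPolynomial.rename some c) = C c := by
  induction c using MvPolynomial.induction_on with
  | C r => simp
  | add p q hp hq => rw [map_add, map_add, hp, hq, C_add]
  | mul_X p i hp => rw [map_mul, map_mul, hp, MvPolynomial.rename_X,
      MvPolynomial.optionEquivLeft_X_some, C_mul]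

theorem optionEquivLeft_map {k L σ : Type*} [Field k] [Field L] (φ : k →+* L)
    (w : MvPolynomial (Option σ) k) :
    MvPolynomial.optionEquivLeft L σ (MvPolynomial.map φ w) =
      (MvPolynomial.optionEquivLeft k σ w).map (MvPolynomial.map φ) := by
  induction w using MvPolynomial.induction_on with
  | C r => simp
  | add p q hp hq => rw [map_add, map_add, hp, hq, map_add, Polynomial.map_add]
  | mul_X p o hp =>
    rw [map_mul, map_mul, hp, map_mul, Polynomial.map_mul]
    cases o <;> simp

/-- The resultant is a combination of `p` and its derivative, so it keeps the roots of a
specialization simple. A constant `p` has resultant `1` and needs the leading coefficient. -/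
theorem separable_specialize {K : Type*} [Field K] [Algebra ℚ K] {η : Fin t → K}
    {p : (MvPolynomial (Fin t) ℚ)[X]} (hlc : MvPolynomial.aeval η p.leadingCoeff ≠ 0)
    (hres : MvPolynomial.aeval η (resultant p (derivative p)) ≠ 0) :
    (specialize η p).Separable := by
  by_cases h0 : p.natDegree = 0
  · obtain ⟨c, rfl⟩ := natDegree_eq_zero.1 h0
    rw [specialize_C, separable_C, isUnit_iff_ne_zero]
    simpa using hlc
  · obtain ⟨x, y, -, -, h⟩ := exists_mul_add_mul_eq_C_resultant p (derivative p) le_rfl le_rfl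
      (Or.inl h0)
    have h' := congrArg (specialize η) h
    rw [specialize_C, specialize, Polynomial.map_add, Polynomial.map_mul, Polynomial.map_mul,
      ← derivative_map] at h'
    refine ⟨C (MvPolynomial.aeval η (resultant p (derivative p)))⁻¹ * specialize η x,
      C (MvPolynomial.aeval η (resultant p (derivative p)))⁻¹ * specialize η y, ?_⟩
    have : (C (MvPolynomial.aeval η (resultant p (derivative p)))⁻¹ : K[X]) *
        C (MvPolynomial.aeval η (resultant p (derivative p))) = 1 := by
      rw [← C_mul, inv_mul_cancel₀ hres, C_1]
    rw [← this, ← h']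
    simp only [specialize]
    ring

theorem eval_specialize_derivative_ne_zero {K : Type*} [Field K] [Algebra ℚ K] {η : Fin t → K}
    {p : (MvPolynomial (Fin t) ℚ)[X]} (hlc : MvPolynomial.aeval η p.leadingCoeff ≠ 0)
    (hres : MvPolynomial.aeval η (resultant p (derivative p)) ≠ 0) {ϑ : K}
    (h : (specialize η p).eval ϑ = 0) : (specialize η (derivative p)).eval ϑ ≠ 0 := by
  have := (separable_specialize hlc hres).eval₂_derivative_ne_zero (RingHom.id K) (x := ϑ)
    (by simpa using h)
  rw [eval₂_id, specialize, derivative_map] at this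
  exact this

theorem resultant_derivative_ne_zero {w : MvPolynomial (Option (Fin t)) ℚ} (hs : Squarefree w)
    (hp : (inU w).IsPrimitive) : resultant (inU w) (derivative (inU w)) ≠ 0 := by
  have : NormalizedGCDMonoid (MvPolynomial (Fin t) ℚ) := Classical.arbitrary _
  have hsq : Squarefree (inU w) := by
    intro x hx
    obtain ⟨z, rfl⟩ := (MvPolynomial.optionEquivLeft ℚ (Fin t)).surjective x
    rw [inU, ← map_mul, map_dvd_iff] at hx
    exact (hs z hx).map _
  have hinj := IsFractionRing.injective (MvPolynomial (Fin t) ℚ) (RatFun t)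
  have hsep := PerfectField.separable_iff_squarefree.2 (IsPrimitive.squarefree_map hp hsq)
  have h := resultant_ne_zero _ _ hsep
  rw [derivative_map, natDegree_map_eq_of_injective hinj, natDegree_map_eq_of_injective hinj,
    resultant_map_map] at h
  exact fun h0 => h (by rw [h0, map_zero])

/-- Sets on which no nonzero polynomial vanishes identically. -/
def IsZariskiDense {σ : Type*} (S : Set (σ → ℂ)) : Prop :=
  ∀ r : MvPolynomial σ ℂ, (∀ η ∈ S, MvPolynomial.aeval η r = 0) → r = 0

theorem aeval_map_complex {σ : Type*} (η : σ → ℂ) (D : MvPolynomial σ ℚ) :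
    MvPolynomial.aeval η (MvPolynomial.map (algebraMap ℚ ℂ) D) = MvPolynomial.aeval η D :=
  MvPolynomial.aeval_map_algebraMap ℂ η D

theorem map_complex_ne_zero {σ : Type*} {D : MvPolynomial σ ℚ} (hD : D ≠ 0) :
    MvPolynomial.map (algebraMap ℚ ℂ) D ≠ 0 := by
  rwa [Ne, map_eq_zero_iff _ (MvPolynomial.map_injective _ (algebraMap ℚ ℂ).injective)]

theorem IsZariskiDense.inter_ne_zero {σ : Type*} {S : Set (σ → ℂ)} (hS : IsZariskiDense S)
    {D : MvPolynomial σ ℂ} (hD : D ≠ 0) :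
    IsZariskiDense {η ∈ S | MvPolynomial.aeval η D ≠ 0} := by
  intro r hr
  have := hS (r * D) fun η hη => by
    rw [map_mul]
    by_cases h : MvPolynomial.aeval η D = 0
    · rw [h, mul_zero]
    · rw [hr η ⟨hη, h⟩, zero_mul]
  exact (mul_eq_zero.1 this).resolve_right hD

theorem isZariskiDense_rational (σ : Type*) :
    IsZariskiDense (Set.range fun (q : σ → ℚ) (i : σ) => (q i : ℂ)) := by
  intro r hr
  refine MvPolynomial.funext_set (fun _ : σ => Set.range ((↑) : ℚ → ℂ))
    (fun _ => Set.infinite_range_of_injective Rat.cast_injective) fun x hx => ?_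
  choose q hq using fun i => hx i (Set.mem_univ i)
  rw [map_zero]
  have := hr x ⟨q, funext hq⟩
  rwa [MvPolynomial.aeval_eq_eval] at this

theorem isZariskiDense_univ (σ : Type*) : IsZariskiDense (Set.univ : Set (σ → ℂ)) :=
  fun r hr => isZariskiDense_rational σ r fun η _ => hr η (Set.mem_univ η)

theorem IsZariskiDense.nonempty {σ : Type*} {S : Set (σ → ℂ)} (hS : IsZariskiDense S) :
    S.Nonempty := by
  by_contra h
  rw [Set.not_nonempty_iff_eq_empty] at h
  exact one_ne_zero (hS 1 (by simp [h]))

theorem eval_map_eval_optionEquivLeft (η : Fin t → ℂ) (ϑ : ℂ)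
    (g : MvPolynomial (Option (Fin t)) ℂ) :
    ((MvPolynomial.optionEquivLeft ℂ (Fin t) g).map (MvPolynomial.eval η)).eval ϑ =
      MvPolynomial.aeval (pointYU η ϑ) g :=
  (MvPolynomial.optionEquivLeft_elim_eval ℂ (Fin t) η ϑ g).symm

/-- A polynomial that vanishes at the points of the hypersurface `w = 0` over a Zariski dense set
of parameters, at each of which `w` keeps its degree in `u` and has simple roots, is a multiple
of `w`. The remainder of a pseudo-division has more roots than its degree allows, and the power of
the leading coefficient by which `g` gets multiplied can be cancelled since `w` is primitive. -/
theorem map_dvd_of_forall_aeval_eq_zero {w : MvPolynomial (Option (Fin t)) ℚ}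
    (hp : (inU w).IsPrimitive) {S : Set (Fin t → ℂ)} (hS : IsZariskiDense S)
    (hlc : ∀ η ∈ S, MvPolynomial.aeval η (inU w).leadingCoeff ≠ 0)
    (hres : ∀ η ∈ S, MvPolynomial.aeval η (resultant (inU w) (derivative (inU w))) ≠ 0)
    {g : MvPolynomial (Option (Fin t)) ℂ}
    (hg : ∀ η ∈ S, ∀ ϑ, (specialize η (inU w)).eval ϑ = 0 →
      MvPolynomial.aeval (pointYU η ϑ) g = 0) :
    MvPolynomial.map (algebraMap ℚ ℂ) w ∣ g := by
  have : NormalizedGCDMonoid (MvPolynomial (Fin t) ℚ) := Classical.arbitrary _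
  set φ : MvPolynomial (Fin t) ℚ →+* MvPolynomial (Fin t) ℂ := MvPolynomial.map (algebraMap ℚ ℂ)
  have hφ : Function.Injective φ := MvPolynomial.map_injective _ (algebraMap ℚ ℂ).injective
  have hwC : MvPolynomial.optionEquivLeft ℂ (Fin t) (MvPolynomial.map (algebraMap ℚ ℂ) w) =
      (inU w).map φ := optionEquivLeft_map _ w
  have hspec : ∀ η : Fin t → ℂ, ((inU w).map φ).map (MvPolynomial.eval η) =
      specialize η (inU w) := fun η => by
    rw [specialize, Polynomial.map_map]
    congr 1
    ext x
    · simp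
    · simp [φ]
  have hw0 : (inU w).map φ ≠ 0 := by
    rw [Polynomial.map_ne_zero_iff hφ]; exact hp.ne_zero
  obtain ⟨N, q, r, hqr, hr⟩ := exists_pow_leadingCoeff_mul_eq ((inU w).map φ) hw0
    (MvPolynomial.optionEquivLeft ℂ (Fin t) g)
  have hr0 : r = 0 := by
    ext1 k
    refine hS _ fun η hη => ?_
    have hsep := separable_specialize (hlc η hη) (hres η hη)
    have hdeg : (specialize η (inU w)).natDegree = (inU w).natDegree :=
      natDegree_map_of_leadingCoeff_ne_zero _ (hlc η hη)
    have hP0 : specialize η (inU w) ≠ 0 := hsep.ne_zero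
    have hrη : r.map (MvPolynomial.eval η) = 0 := by
      by_contra hne
      have hroot : (specialize η (inU w)).roots.toFinset ⊆
          (r.map (MvPolynomial.eval η)).roots.toFinset := by
        intro ϑ hϑ
        rw [Multiset.mem_toFinset, mem_roots hP0] at hϑ
        rw [Multiset.mem_toFinset, mem_roots hne, IsRoot.def]
        have h1 := congrArg (fun s => (s.map (MvPolynomial.eval η)).eval ϑ) hqr
        simp only [Polynomial.map_mul, Polynomial.map_add, eval_mul, eval_add, hspec,
          eval_map_eval_optionEquivLeft] at h1
        rw [hg η hη ϑ hϑ, hϑ.eq_zero, mul_zero, mul_zero, zero_add] at h1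
        exact h1.symm
      have h2 := Finset.card_le_card hroot
      rw [Multiset.toFinset_card_of_nodup (nodup_roots hsep),
        ← (IsAlgClosed.splits _).natDegree_eq_card_roots, hdeg] at h2
      have h3 := (Multiset.toFinset_card_le _).trans
        ((card_roots' (r.map (MvPolynomial.eval η))).trans natDegree_map_le)
      have h4 : r ≠ 0 := by rintro rfl; simp at hne
      have h5 := natDegree_lt_natDegree h4 hr
      rw [natDegree_map_eq_of_injective hφ] at h5
      omega
    have := congrArg (fun s => s.coeff k) hrη
    simpa [MvPolynomial.coe_aeval_eq_eval] using this
  rw [hr0, add_zero] at hqr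
  refine map_dvd_of_dvd_map_mul (D := MvPolynomial.rename some ((inU w).leadingCoeff ^ N)) ?_ ?_
  · intro h hh
    rw [← map_dvd_iff (MvPolynomial.optionEquivLeft ℚ (Fin t)), map_mul,
      optionEquivLeft_rename_some] at hh
    rw [← map_dvd_iff (MvPolynomial.optionEquivLeft ℚ (Fin t))]
    exact IsPrimitive.dvd_of_dvd_C_mul hp
      (pow_ne_zero _ (leadingCoeff_ne_zero.2 hp.ne_zero)) hh
  · rw [← map_dvd_iff (MvPolynomial.optionEquivLeft ℂ (Fin t)), hwC, map_mul,
      optionEquivLeft_map, optionEquivLeft_rename_some, map_C, map_pow]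
    rw [leadingCoeff_map_of_injective hφ] at hqr
    exact ⟨q, by rw [mul_comm _ q, ← hqr]⟩

end

/-! ### Dominance, and the identities satisfied by a parametric resolution -/

section

variable {t n m : ℕ}

/-- The component is the zero locus of a minimal prime over the vanishing ideal of `V` that lies in
the maximal ideal of `p`. -/
theorem exists_isComponent_mem {σ : Type*} [Finite σ] {V : Set (σ → ℂ)}
    (hV : zariskiClosure V = V) {p : σ → ℂ} (hp : p ∈ V) : ∃ Z, IsComponent Z V ∧ p ∈ Z := by
  have hle : MvPolynomial.vanishingIdeal ℂ V ≤ MvPolynomial.vanishingIdeal ℂ {p} :=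
    MvPolynomial.vanishingIdeal_anti_mono (Set.singleton_subset_iff.2 hp)
  obtain ⟨P, hPmin, hPle⟩ := Ideal.exists_minimalPrimes_le hle
  have hP : P.IsPrime := hPmin.1.1
  have hvP : MvPolynomial.vanishingIdeal ℂ (MvPolynomial.zeroLocus ℂ P) = P :=
    MvPolynomial.IsPrime.vanishingIdeal_zeroLocus P
  refine ⟨MvPolynomial.zeroLocus ℂ P, ⟨⟨⟨?_, ?_⟩, ?_⟩, ?_⟩, fun q hq => hPle hq p rfl⟩
  · rw [zariskiClosure, hvP]
  · rwa [hvP]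
  · exact (MvPolynomial.zeroLocus_anti_mono hPmin.1.2).trans hV.le
  · rintro W ⟨⟨hW, hWp⟩, hWV⟩ hZW
    have h1 : MvPolynomial.vanishingIdeal ℂ W ≤ P :=
      (MvPolynomial.vanishingIdeal_anti_mono hZW).trans hvP.le
    have h2 := hPmin.2 ⟨hWp, MvPolynomial.vanishingIdeal_anti_mono hWV⟩ h1
    change zariskiClosure W = W at hW
    rw [← hW]
    exact MvPolynomial.zeroLocus_anti_mono h2

theorem mem_variety_iff {f : Fin m → MvPolynomial (Fin t ⊕ Fin n) ℚ} {z : Fin t ⊕ Fin n → ℂ} :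
    z ∈ variety f ↔ ∀ j, MvPolynomial.aeval z (f j) = 0 := by
  rw [variety, MvPolynomial.zeroLocus_span]
  simp

theorem sumElim_mem_variety_iff {f : Fin m → MvPolynomial (Fin t ⊕ Fin n) ℚ} {η : Fin t → ℂ}
    {x : Fin n → ℂ} : Sum.elim η x ∈ variety f ↔ x ∈ solutions ℂ f η := mem_variety_iff

theorem zariskiClosure_variety (f : Fin m → MvPolynomial (Fin t ⊕ Fin n) ℚ) :
    zariskiClosure (variety f) = variety f := by
  refine subset_antisymm (fun z hz => ?_) (MvPolynomial.zeroLocus_vanishingIdeal_le _)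
  refine mem_variety_iff.2 fun j => ?_
  rw [← aeval_map_complex]
  exact hz _ fun x hx => by rw [aeval_map_complex]; exact mem_variety_iff.1 hx j

theorem IsZariskiOpen.exists_ne_zero {σ : Type*} {Y : Set (σ → ℂ)} (hY : IsZariskiOpen Y)
    (hYne : Y.Nonempty) : ∃ D : MvPolynomial σ ℂ, D ≠ 0 ∧
      ∀ η, MvPolynomial.aeval η D ≠ 0 → η ∈ Y := by
  obtain ⟨I, rfl⟩ := hY
  obtain ⟨η₀, hη₀⟩ := hYne
  obtain ⟨D, hDI, hD⟩ : ∃ D ∈ I, MvPolynomial.aeval η₀ D ≠ 0 := by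
    simpa [MvPolynomial.mem_zeroLocus_iff] using hη₀
  exact ⟨D, by rintro rfl; simp at hD, fun η hη h' => hη (h' D hDI)⟩

/-- By dominance, every component of the variety has points over any non-empty open set of
parameters, so that such points are dense in the variety. -/
theorem AssumptionB.aeval_eq_zero {f : Fin m → MvPolynomial (Fin t ⊕ Fin n) ℚ}
    (hf : AssumptionB f) {Y : Set (Fin t → ℂ)} (hY : IsZariskiOpen Y) (hYne : Y.Nonempty)
    {h : MvPolynomial (Fin t ⊕ Fin n) ℂ}
    (hh : ∀ z ∈ variety f, (fun i => z (Sum.inl i)) ∈ Y → MvPolynomial.aeval z h = 0) :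
    ∀ z ∈ variety f, MvPolynomial.aeval z h = 0 := by
  intro z hz
  obtain ⟨D, hD, hDY⟩ := hY.exists_ne_zero hYne
  obtain ⟨Z, hZ, hzZ⟩ := exists_isComponent_mem (zariskiClosure_variety f) hz
  have hprime := hZ.1.1.2
  have hmul : h * MvPolynomial.rename Sum.inl D ∈ MvPolynomial.vanishingIdeal ℂ Z := by
    intro x hx
    rw [map_mul, MvPolynomial.aeval_rename]
    by_cases hDx : MvPolynomial.aeval (x ∘ Sum.inl) D = 0
    · rw [hDx, mul_zero]
    · rw [hh x (hZ.1.2 hx) (hDY _ hDx), zero_mul]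
  rcases hprime.mem_or_mem hmul with h1 | h1
  · exact h1 z hzZ
  · exfalso
    refine hD (isZariskiDense_univ _ D fun η₀ _ => ?_)
    have hη : η₀ ∈ zariskiClosure
        ((fun (z : Fin t ⊕ Fin n → ℂ) (i : Fin t) => z (Sum.inl i)) '' Z) := by
      rw [hf.dominant Z hZ]; trivial
    refine hη D ?_
    rintro _ ⟨x, hx, rfl⟩
    have := h1 x hx
    rwa [MvPolynomial.aeval_rename] at this

/-- By the Nullstellensatz, what vanishes at the solutions over a non-empty open set of parameters
belongs to the radical ideal `⟨f⟩`. -/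
theorem AssumptionB.mem_span {f : Fin m → MvPolynomial (Fin t ⊕ Fin n) ℚ}
    (hf : AssumptionB f) {Y : Set (Fin t → ℂ)} (hY : IsZariskiOpen Y) (hYne : Y.Nonempty)
    {h : MvPolynomial (Fin t ⊕ Fin n) ℚ}
    (hh : ∀ η ∈ Y, ∀ x ∈ solutions ℂ f η, MvPolynomial.aeval (Sum.elim η x) h = 0) :
    h ∈ Ideal.span (Set.range f) := by
  rw [← hf.radical.radical, ← MvPolynomial.vanishingIdeal_zeroLocus_eq_radical (K := ℂ)]
  intro z hz
  rw [← aeval_map_complex]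
  refine hf.aeval_eq_zero hY hYne (fun z hz hzY => ?_) z hz
  rw [aeval_map_complex]
  have hsplit : z = Sum.elim (fun i => z (Sum.inl i)) (fun i => z (Sum.inr i)) :=
    (Sum.elim_comp_inl_inr z).symm
  rw [hsplit]
  exact hh _ hzY _ (sumElim_mem_variety_iff.1 (hsplit ▸ hz))

/-- Where the three polynomials that define the good set, with `E` a common denominator of the
parametrization, do not vanish. -/
structure IsGood {K : Type*} [Field K] [Algebra ℚ K] (w : MvPolynomial (Option (Fin t)) ℚ)
    (E : MvPolynomial (Fin t) ℚ) (η : Fin t → K) : Prop where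
  leadingCoeff : MvPolynomial.aeval η (inU w).leadingCoeff ≠ 0
  resultant : MvPolynomial.aeval η (resultant (inU w) (derivative (inU w))) ≠ 0
  denom : MvPolynomial.aeval η E ≠ 0

/-- A parametric resolution `xᵢ = Vᵢ / (E w')` with integral numerators `Vᵢ` and a common
denominator `E`, expressed by polynomial identities. -/
structure IsClearedResolution (f : Fin m → MvPolynomial (Fin t ⊕ Fin n) ℚ) (a : Fin n → ℚ)
    (w : MvPolynomial (Option (Fin t)) ℚ) (E : MvPolynomial (Fin t) ℚ)
    (V : Fin n → (MvPolynomial (Fin t) ℚ)[X]) : Prop where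
  ne_zero : E ≠ 0
  linear_dvd : inU w ∣ (∑ i, C (MvPolynomial.C (a i)) * V i) - X * (C E * derivative (inU w))
  elim_mem : substU a (inU w) ∈ Ideal.span (Set.range f)
  param_mem : ∀ i, substU a (C E * derivative (inU w)) * MvPolynomial.X (Sum.inr i) -
    substU a (V i) ∈ Ideal.span (Set.range f)
  solves : ∀ (η : Fin t → ℂ) (ϑ : ℂ), IsGood w E η → (specialize η (inU w)).eval ϑ = 0 →
    (fun i => (specialize η (V i)).eval ϑ /
      (specialize η (C E * derivative (inU w))).eval ϑ) ∈ solutions ℂ f η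

/-- Substitution of `xᵢ = Vᵢ / Q` in `p`, with denominators cleared by a power of `Q`. -/
theorem exists_eval_specialize_eq_pow_mul (p : MvPolynomial (Fin t ⊕ Fin n) ℚ)
    (Q : (MvPolynomial (Fin t) ℚ)[X]) (V : Fin n → (MvPolynomial (Fin t) ℚ)[X]) :
    ∃ (F : (MvPolynomial (Fin t) ℚ)[X]) (N : ℕ), ∀ (η : Fin t → ℂ) (ϑ : ℂ),
      (specialize η Q).eval ϑ ≠ 0 → (specialize η F).eval ϑ = (specialize η Q).eval ϑ ^ N *
        MvPolynomial.aeval (Sum.elim η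
          fun i => (specialize η (V i)).eval ϑ / (specialize η Q).eval ϑ) p := by
  induction p using MvPolynomial.induction_on with
  | C r => exact ⟨C (MvPolynomial.C r), 0, fun η ϑ _ => by simp [specialize]⟩
  | add p q hp hq =>
    obtain ⟨F, N, hF⟩ := hp
    obtain ⟨G, M, hG⟩ := hq
    refine ⟨F * Q ^ M + G * Q ^ N, N + M, fun η ϑ h => ?_⟩
    have h1 := hF η ϑ h
    have h2 := hG η ϑ h
    simp only [specialize] at h1 h2 ⊢
    rw [Polynomial.map_add, Polynomial.map_mul, Polynomial.map_mul, Polynomial.map_pow,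
      Polynomial.map_pow, eval_add, eval_mul, eval_mul, eval_pow, eval_pow, h1, h2, map_add]
    ring
  | mul_X p o hp =>
    obtain ⟨F, N, hF⟩ := hp
    cases o with
    | inl i =>
      refine ⟨F * C (MvPolynomial.X i), N, fun η ϑ h => ?_⟩
      rw [specialize_mul, specialize_C, eval_mul, hF η ϑ h, map_mul]
      simp [mul_assoc]
    | inr i =>
      refine ⟨F * V i, N + 1, fun η ϑ h => ?_⟩
      rw [specialize_mul, eval_mul, hF η ϑ h, map_mul, MvPolynomial.aeval_X, Sum.elim_inr]
      field_simp
      ring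

theorem IsParametricResolution.linear_dvd_cleared {f : Fin m → MvPolynomial (Fin t ⊕ Fin n) ℚ}
    {a : Fin n → ℚ} {w : MvPolynomial (Option (Fin t)) ℚ} {v : Fin n → (RatFun t)[X]}
    (hw : IsParametricResolution f a w v) {E : MvPolynomial (Fin t) ℚ}
    {V : Fin n → (MvPolynomial (Fin t) ℚ)[X]}
    (hV : ∀ i, (V i).map (algebraMap _ (RatFun t)) = C (algebraMap _ (RatFun t) E) * v i) :
    inU w ∣ (∑ i, C (MvPolynomial.C (a i)) * V i) - X * (C E * derivative (inU w)) := by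
  have : NormalizedGCDMonoid (MvPolynomial (Fin t) ℚ) := Classical.arbitrary _
  refine hw.primitive.dvd_of_fraction_map_dvd_fraction_map (K := RatFun t) ?_
  convert! hw.linearForm.mul_left (C (algebraMap _ (RatFun t) E)) using 1
  rw [Polynomial.map_sub, Polynomial.map_sum, mul_sub, Finset.mul_sum]
  congr 1
  · refine Finset.sum_congr rfl fun i _ => ?_
    rw [Polynomial.map_mul, hV, map_C, ← MvPolynomial.algebraMap_eq,
      ← IsScalarTower.algebraMap_apply]
    ring
  · rw [Polynomial.map_mul, Polynomial.map_mul, map_C, map_X]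
    ring

/-- If `p` divides `∑ aᵢ Vᵢ - u Q`, the linear form takes the value `ϑ` at the point with
coordinates `Vᵢ / Q` given by a root `ϑ` of `p`. -/
theorem linVal_eq_of_dvd {K : Type*} [Field K] [Algebra ℚ K] {a : Fin n → ℚ}
    {p Q : (MvPolynomial (Fin t) ℚ)[X]} {V : Fin n → (MvPolynomial (Fin t) ℚ)[X]}
    (h : p ∣ (∑ i, C (MvPolynomial.C (a i)) * V i) - X * Q) {η : Fin t → K} {ϑ : K}
    (hϑ : (specialize η p).eval ϑ = 0) (hQ : (specialize η Q).eval ϑ ≠ 0) {x : Fin n → K}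
    (hx : ∀ i, (specialize η (V i)).eval ϑ = x i * (specialize η Q).eval ϑ) :
    linVal a x = ϑ := by
  obtain ⟨q, hq⟩ := h
  have h1 := congrArg (fun s => (specialize η s).eval ϑ) hq
  simp only [specialize] at h1 hϑ hx hQ
  simp only [Polynomial.map_sub, Polynomial.map_sum, Polynomial.map_mul, eval_sub,
    eval_finsetSum, eval_mul, map_C, map_X, eval_C, eval_X, hϑ, hx, zero_mul] at h1
  refine mul_right_cancel₀ hQ ?_
  rw [← sub_eq_zero, ← h1, linVal, Finset.sum_mul]
  congr 1
  refine Finset.sum_congr rfl fun i _ => ?_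
  simp [mul_assoc]

theorem exists_isGood_iff {w : MvPolynomial (Option (Fin t)) ℚ} (hs : Squarefree w)
    (hp : (inU w).IsPrimitive) {E : MvPolynomial (Fin t) ℚ} (hE : E ≠ 0) :
    ∃ D : MvPolynomial (Fin t) ℂ, D ≠ 0 ∧
      ∀ η : Fin t → ℂ, IsGood w E η ↔ MvPolynomial.aeval η D ≠ 0 := by
  refine ⟨MvPolynomial.map (algebraMap ℚ ℂ) ((inU w).leadingCoeff *
    resultant (inU w) (derivative (inU w)) * E), map_complex_ne_zero (mul_ne_zero (mul_ne_zero
      (leadingCoeff_ne_zero.2 hp.ne_zero) (resultant_derivative_ne_zero hs hp)) hE), fun η => ?_⟩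
  rw [aeval_map_complex, map_mul, map_mul, mul_ne_zero_iff, mul_ne_zero_iff]
  exact ⟨fun h => ⟨⟨h.1, h.2⟩, h.3⟩, fun h => ⟨h.1.1, h.1.2, h.2⟩⟩

theorem IsGood.eval_denom_ne_zero {K : Type*} [Field K] [Algebra ℚ K]
    {w : MvPolynomial (Option (Fin t)) ℚ} {E : MvPolynomial (Fin t) ℚ} {η : Fin t → K}
    (h : IsGood w E η) {ϑ : K} (hϑ : (specialize η (inU w)).eval ϑ = 0) :
    (specialize η (C E * derivative (inU w))).eval ϑ ≠ 0 := by
  rw [specialize_mul, specialize_C, eval_mul, eval_C]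
  exact mul_ne_zero h.denom (eval_specialize_derivative_ne_zero h.leadingCoeff h.resultant hϑ)

/-- The identities behind a parametric resolution hold over all good parameters, not only over the
open set on which the solutions are assumed to be parametrized. -/
theorem IsParametricResolution.isClearedResolution
    {f : Fin m → MvPolynomial (Fin t ⊕ Fin n) ℚ} (hf : AssumptionB f)
    {a : Fin n → ℚ} {w : MvPolynomial (Option (Fin t)) ℚ} {v : Fin n → (RatFun t)[X]}
    (hw : IsParametricResolution f a w v) {E : MvPolynomial (Fin t) ℚ}
    {V : Fin n → (MvPolynomial (Fin t) ℚ)[X]} (hE : E ≠ 0)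
    (hEη : ∀ η : Fin t → ℂ, DenomsNonzero v η ↔ MvPolynomial.aeval η E ≠ 0)
    (hV : ∀ i, (V i).map (algebraMap _ (RatFun t)) = C (algebraMap _ (RatFun t) E) * v i) :
    IsClearedResolution f a w E V := by
  obtain ⟨Y, hY, hYne, hYsol⟩ := hw.parametrizes
  have hlin := hw.linear_dvd_cleared hV
  have hval : ∀ η ∈ Y, ∀ i ϑ, (specialize η (V i)).eval ϑ =
      MvPolynomial.aeval η E * ratPolyEval η ϑ (v i) := fun η hη i ϑ =>
    eval_specialize_cleared hE (hV i) η ((hYsol η hη).1 i) ϑ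
  have hgen : ∀ η ∈ Y, ∀ x ∈ solutions ℂ f η, (specialize η (inU w)).eval (linVal a x) = 0 ∧
      ∀ i, (specialize η (V i)).eval (linVal a x) =
        x i * (specialize η (C E * derivative (inU w))).eval (linVal a x) := by
    intro η hη x hx
    rw [(hYsol η hη).2] at hx
    obtain ⟨ϑ, hϑ, hϑ', hx⟩ := hx
    have hx' : ∀ i, (specialize η (V i)).eval ϑ =
        x i * (specialize η (C E * derivative (inU w))).eval ϑ := fun i => by
      rw [hval η hη, hx, specialize_mul, specialize_C, eval_mul, eval_C]
      field_simp
    have hQ : (specialize η (C E * derivative (inU w))).eval ϑ ≠ 0 := by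
      rw [specialize_mul, specialize_C, eval_mul, eval_C]
      exact mul_ne_zero ((hEη η).1 (hYsol η hη).1) hϑ'
    rw [linVal_eq_of_dvd hlin hϑ hQ hx']
    exact ⟨hϑ, hx'⟩
  refine ⟨hE, hlin, hf.mem_span hY hYne fun η hη x hx => ?_, fun i =>
    hf.mem_span hY hYne fun η hη x hx => ?_, fun η ϑ hη hϑ => ?_⟩
  · rw [aeval_substU]
    exact (hgen η hη x hx).1
  · rw [map_sub, map_mul, aeval_substU, aeval_substU, (hgen η hη x hx).2 i, MvPolynomial.aeval_X,
      Sum.elim_inr, mul_comm, sub_self]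
  · obtain ⟨D, hD, hDY⟩ := hY.exists_ne_zero hYne
    obtain ⟨D', hD', hDgood⟩ := exists_isGood_iff hw.squarefree hw.primitive hE
    have hS := (isZariskiDense_univ (Fin t)).inter_ne_zero (mul_ne_zero hD hD')
    have hSY : ∀ η' ∈ {η ∈ Set.univ | MvPolynomial.aeval η (D * D') ≠ 0},
        η' ∈ Y ∧ IsGood w E η' := by
      rintro η' ⟨-, h⟩
      rw [map_mul, mul_ne_zero_iff] at h
      exact ⟨hDY _ h.1, (hDgood _).2 h.2⟩
    intro j
    obtain ⟨F, N, hF⟩ := exists_eval_specialize_eq_pow_mul (f j) (C E * derivative (inU w)) V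
    obtain ⟨g, rfl⟩ := (MvPolynomial.optionEquivLeft ℚ (Fin t)).surjective F
    have hdvd := map_dvd_of_forall_aeval_eq_zero hw.primitive hS
      (fun η' h => (hSY η' h).2.leadingCoeff) (fun η' h => (hSY η' h).2.resultant)
      (g := MvPolynomial.map (algebraMap ℚ ℂ) g) (fun η' h ϑ' hϑ' => by
        have hQ := (hSY η' h).2.eval_denom_ne_zero hϑ'
        rw [aeval_map_complex, ← eval_specialize_inU, inU, hF η' ϑ' hQ]
        have : (fun i => (specialize η' (V i)).eval ϑ' /
            (specialize η' (C E * derivative (inU w))).eval ϑ') ∈ solutions ℂ f η' := by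
          rw [(hYsol η' (hSY η' h).1).2]
          have hw' := eval_specialize_derivative_ne_zero (hSY η' h).2.leadingCoeff
            (hSY η' h).2.resultant hϑ'
          refine ⟨ϑ', hϑ', hw', fun i => ?_⟩
          beta_reduce
          rw [hval η' (hSY η' h).1, specialize_mul, specialize_C, eval_mul, eval_C,
            mul_div_mul_left _ _ (hSY η' h).2.denom]
        rw [this j, mul_zero])
    have hQ := hη.eval_denom_ne_zero hϑ
    have h0 : MvPolynomial.aeval (pointYU η ϑ) (MvPolynomial.map (algebraMap ℚ ℂ) g) = 0 := by
      obtain ⟨q, hq⟩ := hdvd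
      rw [hq, map_mul, aeval_map_complex, ← eval_specialize_inU, hϑ, zero_mul]
    rw [aeval_map_complex, ← eval_specialize_inU, inU, hF η ϑ hQ] at h0
    exact (mul_eq_zero.1 h0).resolve_left (pow_ne_zero _ hQ)

end

/-! ### Real solutions and the elimination ideal -/

section

variable {t n m : ℕ}

theorem aeval_eq_zero_of_mem_span {σ K : Type*} [Field K] [Algebra ℚ K]
    {f : Fin m → MvPolynomial σ ℚ} {z : σ → K} (hz : ∀ j, MvPolynomial.aeval z (f j) = 0)
    {h : MvPolynomial σ ℚ} (hh : h ∈ Ideal.span (Set.range f)) : MvPolynomial.aeval z h = 0 := by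
  have : Ideal.span (Set.range f) ≤ RingHom.ker (MvPolynomial.aeval z : _ →ₐ[ℚ] K) := by
    rw [Ideal.span_le]
    rintro _ ⟨j, rfl⟩
    exact hz j
  exact this hh

section Cleared

variable {f : Fin m → MvPolynomial (Fin t ⊕ Fin n) ℚ} {a : Fin n → ℚ}
  {w : MvPolynomial (Option (Fin t)) ℚ} {E : MvPolynomial (Fin t) ℚ}
  {V : Fin n → (MvPolynomial (Fin t) ℚ)[X]} {K : Type*} [Field K] [Algebra ℚ K]

theorem IsClearedResolution.eval_linVal (hc : IsClearedResolution f a w E V) {η : Fin t → K}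
    {x : Fin n → K} (hx : x ∈ solutions K f η) :
    (specialize η (inU w)).eval (linVal a x) = 0 := by
  rw [← aeval_substU]
  exact aeval_eq_zero_of_mem_span hx hc.elim_mem

theorem IsClearedResolution.eval_numerator (hc : IsClearedResolution f a w E V) {η : Fin t → K}
    {x : Fin n → K} (hx : x ∈ solutions K f η) (i : Fin n) :
    (specialize η (V i)).eval (linVal a x) =
      x i * (specialize η (C E * derivative (inU w))).eval (linVal a x) := by
  have h := aeval_eq_zero_of_mem_span hx (hc.param_mem i)
  rw [map_sub, map_mul, aeval_substU, aeval_substU, MvPolynomial.aeval_X, Sum.elim_inr,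
    sub_eq_zero] at h
  rw [← h, mul_comm]

theorem IsClearedResolution.injOn_linVal (hc : IsClearedResolution f a w E V) {η : Fin t → K}
    (hη : IsGood w E η) : Set.InjOn (linVal a) (solutions K f η) := by
  intro x hx x' hx' h
  ext i
  have hQ := hη.eval_denom_ne_zero (hc.eval_linVal hx)
  refine mul_right_cancel₀ hQ ?_
  rw [← hc.eval_numerator hx i, h, ← hc.eval_numerator hx' i]

theorem IsClearedResolution.exists_solution (hc : IsClearedResolution f a w E V) {η : Fin t → ℂ}
    (hη : IsGood w E η) {ϑ : ℂ} (hϑ : (specialize η (inU w)).eval ϑ = 0) :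
    ∃ x ∈ solutions ℂ f η, linVal a x = ϑ :=
  ⟨_, hc.solves η ϑ hη hϑ, linVal_eq_of_dvd hc.linear_dvd hϑ (hη.eval_denom_ne_zero hϑ)
    fun _ => (div_mul_cancel₀ _ (hη.eval_denom_ne_zero hϑ)).symm⟩

theorem IsGood.specialize_ne_zero {η : Fin t → K} (hη : IsGood w E η) :
    specialize η (inU w) ≠ 0 :=
  (separable_specialize hη.leadingCoeff hη.resultant).ne_zero

theorem finite_setOf_eval_eq_zero {L : Type*} [Field L] {p : L[X]} (hp : p ≠ 0) :
    {ϑ : L | p.eval ϑ = 0}.Finite := by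
  classical
  refine p.roots.toFinset.finite_toSet.subset fun ϑ hϑ => ?_
  simpa [hp] using hϑ

theorem IsClearedResolution.finite_solutions (hc : IsClearedResolution f a w E V) {η : Fin t → K}
    (hη : IsGood w E η) : (solutions K f η).Finite :=
  Set.Finite.of_finite_image ((finite_setOf_eval_eq_zero hη.specialize_ne_zero).subset
    (Set.image_subset_iff.2 fun _ hx => hc.eval_linVal hx)) (hc.injOn_linVal hη)

theorem specialize_algHom_comp {L : Type*} [Field L] [Algebra ℚ L] (φ : K →ₐ[ℚ] L) (η : Fin t → K)
    (p : (MvPolynomial (Fin t) ℚ)[X]) :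
    specialize (fun i => φ (η i)) p = (specialize η p).map φ.toRingHom := by
  rw [specialize, specialize, Polynomial.map_map]
  congr 1
  ext i
  · simp
  · simp

theorem isGood_algHom_comp_iff {L : Type*} [Field L] [Algebra ℚ L] (φ : K →ₐ[ℚ] L)
    {η : Fin t → K} : IsGood w E (fun i => φ (η i)) ↔ IsGood w E η := by
  have h : ∀ p : MvPolynomial (Fin t) ℚ,
      MvPolynomial.aeval (fun i => φ (η i)) p ≠ 0 ↔ MvPolynomial.aeval η p ≠ 0 := fun p => by
    rw [aeval_algebraMap_comp, Ne, map_eq_zero]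
  exact ⟨fun ⟨h1, h2, h3⟩ => ⟨(h _).1 h1, (h _).1 h2, (h _).1 h3⟩,
    fun ⟨h1, h2, h3⟩ => ⟨(h _).2 h1, (h _).2 h2, (h _).2 h3⟩⟩

theorem IsClearedResolution.encard_real_solutions (hc : IsClearedResolution f a w E V)
    {η : Fin t → ℝ} (hη : IsGood w E η) :
    (solutions ℝ f η).encard = {ϑ : ℝ | (specialize η (inU w)).eval ϑ = 0}.encard := by
  rw [← (hc.injOn_linVal hη).encard_image]
  congr 1
  refine subset_antisymm (Set.image_subset_iff.2 fun x hx => hc.eval_linVal hx) fun ϑ hϑ => ?_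
  change (specialize η (inU w)).eval ϑ = 0 at hϑ
  let φ : ℝ →ₐ[ℚ] ℂ := IsScalarTower.toAlgHom ℚ ℝ ℂ
  have hev : ∀ p : (MvPolynomial (Fin t) ℚ)[X],
      (specialize (fun i => φ (η i)) p).eval (φ ϑ) = φ ((specialize η p).eval ϑ) := fun p => by
    rw [specialize_algHom_comp]
    exact eval_map_apply φ.toRingHom ϑ
  have hx := hc.solves (fun i => φ (η i)) (φ ϑ) ((isGood_algHom_comp_iff φ).2 hη)
    (by rw [hev, hϑ, map_zero])
  have hQ := hη.eval_denom_ne_zero hϑ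
  refine ⟨fun i => (specialize η (V i)).eval ϑ /
    (specialize η (C E * derivative (inU w))).eval ϑ, fun j => ?_,
    linVal_eq_of_dvd hc.linear_dvd hϑ hQ fun i => by rw [div_mul_cancel₀ _ hQ]⟩
  have hj := hx j
  have hpt : Sum.elim (fun i => φ (η i))
      (fun i => (specialize (fun i => φ (η i)) (V i)).eval (φ ϑ) /
      (specialize (fun i => φ (η i)) (C E * derivative (inU w))).eval (φ ϑ)) =
      fun o => φ (Sum.elim η (fun i => (specialize η (V i)).eval ϑ /
        (specialize η (C E * derivative (inU w))).eval ϑ) o) := by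
    ext o
    cases o with
    | inl i => rfl
    | inr i => simp only [Sum.elim_inr, hev, map_div₀]
  rw [hpt, aeval_algebraMap_comp, map_eq_zero] at hj
  exact hj

theorem mem_zeroLocus_idealU_iff {z : Option (Fin t ⊕ Fin n) → ℂ} :
    z ∈ MvPolynomial.zeroLocus ℂ (idealU f a) ↔
      (fun i => z (some i)) ∈ variety f ∧ z none = linVal a fun i => z (some (Sum.inr i)) := by
  rw [idealU, MvPolynomial.zeroLocus_span, mem_variety_iff]
  constructor
  · intro h
    refine ⟨fun j => ?_, ?_⟩
    · have := h _ (Or.inl ⟨j, rfl⟩)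
      rwa [MvPolynomial.aeval_rename] at this
    · have := h _ (Or.inr rfl)
      rw [map_sub, sub_eq_zero] at this
      simpa [linVal] using this
  · rintro ⟨h1, h2⟩ p (⟨j, rfl⟩ | rfl)
    · rw [MvPolynomial.aeval_rename]
      exact h1 j
    · rw [map_sub, sub_eq_zero]
      simpa [linVal] using h2

/-- Modulo the extended ideal, `u` may be replaced by the linear form. -/
theorem rename_sub_rename_substU_mem (p : MvPolynomial (Option (Fin t)) ℚ) :
    MvPolynomial.rename (Option.map Sum.inl) p - MvPolynomial.rename some (substU a (inU p)) ∈
      idealU f a := by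
  induction p using MvPolynomial.induction_on with
  | C r => simp [inU, substU]
  | add p q hp hq =>
    convert! add_mem hp hq using 1
    simp only [inU, map_add]
    ring
  | mul_X p o hp =>
    have hX : MvPolynomial.rename (Option.map Sum.inl) (MvPolynomial.X o) -
        MvPolynomial.rename some (substU a (inU (MvPolynomial.X o))) ∈ idealU f a := by
      cases o with
      | none =>
        refine Ideal.subset_span (Or.inr ?_)
        simp [inU, substU, linForm]
      | some i => simp [inU, substU]
    have h1 := Ideal.mul_mem_right
      (MvPolynomial.rename (Option.map Sum.inl) (MvPolynomial.X o)) _ hp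
    have h2 := Ideal.mul_mem_left _ (MvPolynomial.rename some (substU a (inU p))) hX
    convert! add_mem h1 h2 using 1
    simp only [inU, map_mul]
    ring

theorem IsClearedResolution.mem_elimIdeal (hc : IsClearedResolution f a w E V) :
    w ∈ elimIdeal f a := by
  have h : MvPolynomial.rename some (substU a (inU w)) ∈ idealU f a := by
    have hle : (Ideal.span (Set.range f)).map
        (MvPolynomial.rename some : _ →ₐ[ℚ] MvPolynomial (Option (Fin t ⊕ Fin n)) ℚ) ≤
          idealU f a := by
      rw [Ideal.map_span, Ideal.span_le]
      rintro _ ⟨_, ⟨j, rfl⟩, rfl⟩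
      exact Ideal.subset_span (Or.inl ⟨j, rfl⟩)
    exact hle (Ideal.mem_map_of_mem _ hc.elim_mem)
  have := add_mem (rename_sub_rename_substU_mem (f := f) (a := a) w) h
  rwa [sub_add_cancel] at this

theorem zeroLocus_elimIdeal_subset (hw : w ∈ elimIdeal f a) :
    MvPolynomial.zeroLocus ℂ (elimIdeal f a) ⊆ MvPolynomial.zeroLocus ℂ (Ideal.span {w}) :=
  MvPolynomial.zeroLocus_anti_mono ((Ideal.span_singleton_le_iff_mem _).2 hw)

theorem zariskiClosure_projU_subset :
    zariskiClosure (projU '' MvPolynomial.zeroLocus ℂ (idealU f a)) ⊆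
      MvPolynomial.zeroLocus ℂ (elimIdeal f a) := by
  intro z hz p hp
  rw [← aeval_map_complex]
  refine hz _ ?_
  rintro _ ⟨y, hy, rfl⟩
  rw [aeval_map_complex]
  have := hy _ hp
  rw [MvPolynomial.aeval_rename] at this
  exact this

/-- The points of `w = 0` over good parameters are projections of solutions, and a polynomial that
vanishes at them is a multiple of `w`. -/
theorem IsClearedResolution.zeroLocus_subset_closure (hc : IsClearedResolution f a w E V)
    (hs : Squarefree w) (hp : (inU w).IsPrimitive) :
    MvPolynomial.zeroLocus ℂ (Ideal.span {w}) ⊆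
      zariskiClosure (projU '' MvPolynomial.zeroLocus ℂ (idealU f a)) := by
  intro z hz g hg
  obtain ⟨D, hD, hDgood⟩ := exists_isGood_iff hs hp hc.ne_zero
  have hS := (isZariskiDense_univ (Fin t)).inter_ne_zero hD
  obtain ⟨q, hq⟩ := map_dvd_of_forall_aeval_eq_zero hp hS
    (fun η h => ((hDgood η).2 h.2).leadingCoeff) (fun η h => ((hDgood η).2 h.2).resultant)
    (g := g) fun η h ϑ hϑ => by
      have hη := (hDgood η).2 h.2
      obtain ⟨x, hx, hxϑ⟩ := hc.exists_solution hη hϑ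
      refine hg _ ⟨fun o => o.elim ϑ (Sum.elim η x), ?_, ?_⟩
      · exact mem_zeroLocus_idealU_iff.2 ⟨sumElim_mem_variety_iff.2 hx, hxϑ.symm⟩
      · ext o
        cases o <;> rfl
  rw [hq, map_mul, aeval_map_complex, hz w (Ideal.mem_span_singleton_self w), zero_mul]

end Cleared

end

/-! ### Perturbed systems and their characteristic equations -/

section Perturbation

variable {τ ι : Type*}

open Classical in
/-- The linear map that sends a monomial divisible by some `xᵢᵈ` to the product of its quotient by
`xᵢᵈ` (for one such `i`) with `Gᵢ`, and all other monomials to `0`. Then `ε + topReplace G d` sends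
a monomial of the first kind to a multiple of `Gᵢ + ε xᵢᵈ`. -/
def topReplace (G : ι → MvPolynomial (τ ⊕ ι) ℂ) (d : ℕ) :
    MvPolynomial (τ ⊕ ι) ℂ →ₗ[ℂ] MvPolynomial (τ ⊕ ι) ℂ :=
  (MvPolynomial.basisMonomials (τ ⊕ ι) ℂ).constr ℂ fun μ =>
    if h : ∃ i, d ≤ μ (Sum.inr i) then
      MvPolynomial.monomial (μ - Finsupp.single (Sum.inr h.choose) d) 1 * G h.choose
    else 0

open Classical in
theorem topReplace_monomial (G : ι → MvPolynomial (τ ⊕ ι) ℂ) (d : ℕ) (μ : (τ ⊕ ι) →₀ ℕ) :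
    topReplace G d (MvPolynomial.monomial μ 1) = if h : ∃ i, d ≤ μ (Sum.inr i) then
      MvPolynomial.monomial (μ - Finsupp.single (Sum.inr h.choose) d) 1 * G h.choose
    else 0 := by
  have h := (MvPolynomial.basisMonomials (τ ⊕ ι) ℂ).constr_basis ℂ (fun μ =>
    if h : ∃ i, d ≤ μ (Sum.inr i) then
      MvPolynomial.monomial (μ - Finsupp.single (Sum.inr h.choose) d) 1 * G h.choose
    else 0) μ
  rwa [MvPolynomial.coe_basisMonomials] at h

theorem mem_restrictTotalDegree_induction {σ : Type*} {N : ℕ}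
    (S : Submodule ℂ (MvPolynomial σ ℂ))
    (hS : ∀ μ : σ →₀ ℕ, μ.degree ≤ N → MvPolynomial.monomial μ 1 ∈ S) :
    MvPolynomial.restrictTotalDegree σ ℂ N ≤ S := by
  intro q hq
  rw [MvPolynomial.mem_restrictTotalDegree] at hq
  rw [q.as_sum]
  refine Submodule.sum_mem _ fun μ hμ => ?_
  have h1 : MvPolynomial.monomial μ (q.coeff μ) = q.coeff μ • MvPolynomial.monomial μ (1 : ℂ) := by
    rw [MvPolynomial.smul_monomial, smul_eq_mul, mul_one]
  rw [h1]
  exact S.smul_mem _ (hS μ ((MvPolynomial.le_totalDegree hμ).trans hq))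

theorem topReplace_mem {G : ι → MvPolynomial (τ ⊕ ι) ℂ} {d : ℕ}
    (hG : ∀ i, (G i).totalDegree ≤ d) (N : ℕ) :
    ∀ q ∈ MvPolynomial.restrictTotalDegree (τ ⊕ ι) ℂ N,
      topReplace G d q ∈ MvPolynomial.restrictTotalDegree (τ ⊕ ι) ℂ N := by
  refine mem_restrictTotalDegree_induction
    ((MvPolynomial.restrictTotalDegree (τ ⊕ ι) ℂ N).comap (topReplace G d)) fun μ hμ => ?_
  rw [Submodule.mem_comap, topReplace_monomial]
  split_ifs with h
  · rw [MvPolynomial.mem_restrictTotalDegree]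
    have h1 : (μ - Finsupp.single (Sum.inr h.choose) d).degree + d = μ.degree := by
      have := congrArg Finsupp.degree
        (tsub_add_cancel_of_le (Finsupp.single_le_iff.2 h.choose_spec))
      rwa [map_add, Finsupp.degree_single] at this
    refine (MvPolynomial.totalDegree_mul _ _).trans ?_
    have h2 := MvPolynomial.totalDegree_monomial_le
      (μ - Finsupp.single (Sum.inr h.choose) d) (1 : ℂ)
    have h3 := hG h.choose
    change _ ≤ (μ - Finsupp.single (Sum.inr h.choose) d).degree at h2
    omega
  · exact zero_mem _

/-- Since `topReplace G d` has finitely many eigenvalues on the polynomials of degree at most `N`,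
its perturbation by a small nonzero scalar is surjective. -/
theorem eventually_exists_smul_add_topReplace_eq [Finite τ] [Finite ι]
    {G : ι → MvPolynomial (τ ⊕ ι) ℂ} {d : ℕ}
    (hG : ∀ i, (G i).totalDegree ≤ d) (N : ℕ) :
    ∀ᶠ ε in nhdsWithin (0 : ℂ) {0}ᶜ, ∀ h ∈ MvPolynomial.restrictTotalDegree (τ ⊕ ι) ℂ N,
      ∃ q ∈ MvPolynomial.restrictTotalDegree (τ ⊕ ι) ℂ N, ε • q + topReplace G d q = h := by
  let T := (topReplace G d).restrict (topReplace_mem hG N)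
  have hfin : {ε : ℂ | Module.End.HasEigenvalue T (-ε)}.Finite :=
    (Module.End.finite_hasEigenvalue T).preimage neg_injective.injOn
  have hev : ∀ᶠ ε in nhdsWithin (0 : ℂ) {0}ᶜ, ¬ Module.End.HasEigenvalue T (-ε) :=
    nhdsNE_le_cofinite 0 hfin.eventually_cofinite_notMem
  filter_upwards [hev] with ε hε h hh
  have hinj : Function.Injective
      (ε • (1 : Module.End ℂ (MvPolynomial.restrictTotalDegree (τ ⊕ ι) ℂ N)) + T) := by
    rw [← LinearMap.ker_eq_bot, LinearMap.ker_eq_bot']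
    intro q hq
    by_contra hq0
    refine hε (Module.End.hasEigenvalue_of_hasEigenvector (x := q) ⟨?_, hq0⟩)
    rw [Module.End.mem_eigenspace_iff, neg_smul]
    exact eq_neg_of_add_eq_zero_right hq
  obtain ⟨q, hq⟩ := LinearMap.injective_iff_surjective.1 hinj ⟨h, hh⟩
  exact ⟨q, q.2, congrArg Subtype.val hq⟩

variable [Fintype ι] [DecidableEq ι]

/-- The polynomials that agree, on the zeros of all `Gᵢ + ε xᵢᵈ`, with a combination of the
monomials `x^α` with all `αᵢ < d`, with coefficients in `ℂ[y]` such that no term has degree larger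
than `N`. -/
def reducible (G : ι → MvPolynomial (τ ⊕ ι) ℂ) (d : ℕ) (ε : ℂ) (N : ℕ) :
    Submodule ℂ (MvPolynomial (τ ⊕ ι) ℂ) where
  carrier := {h | ∃ c : (ι → Fin d) → MvPolynomial τ ℂ,
    (∀ α, ∀ s ∈ (c α).support, s.degree + ∑ i, (α i : ℕ) ≤ N) ∧
    ∀ z : τ ⊕ ι → ℂ, (∀ i, MvPolynomial.aeval z (G i) + ε * z (Sum.inr i) ^ d = 0) →
      MvPolynomial.aeval z h =
        ∑ α, MvPolynomial.aeval (z ∘ Sum.inl) (c α) * ∏ i, z (Sum.inr i) ^ (α i : ℕ)}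
  add_mem' := by
    classical
    rintro p q ⟨c, hc, hcz⟩ ⟨e, he, hez⟩
    refine ⟨c + e, fun α s hs => ?_, fun z hz => ?_⟩
    · rcases Finset.mem_union.1 (MvPolynomial.support_add hs) with h | h
      exacts [hc α s h, he α s h]
    · rw [map_add, hcz z hz, hez z hz, ← Finset.sum_add_distrib]
      simp [add_mul]
  zero_mem' := ⟨0, by simp, by simp⟩
  smul_mem' := by
    rintro r p ⟨c, hc, hcz⟩
    refine ⟨r • c, fun α s hs => hc α s (MvPolynomial.support_smul hs), fun z hz => ?_⟩
    rw [map_smul, hcz z hz, Finset.smul_sum]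
    simp [mul_assoc]

theorem mul_mem_reducible (G : ι → MvPolynomial (τ ⊕ ι) ℂ) (d : ℕ) (ε : ℂ) (N : ℕ)
    (i : ι) (p : MvPolynomial (τ ⊕ ι) ℂ) :
    p * (G i + ε • MvPolynomial.X (Sum.inr i) ^ d) ∈ reducible G d ε N := by
  refine ⟨fun _ => 0, by simp, fun z hz => ?_⟩
  rw [map_mul, map_add, map_smul, map_pow, MvPolynomial.aeval_X, smul_eq_mul, hz i, mul_zero]
  simp

variable [Fintype τ]

theorem monomial_mem_reducible (G : ι → MvPolynomial (τ ⊕ ι) ℂ) (d : ℕ) (ε : ℂ) {N : ℕ}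
    {μ : (τ ⊕ ι) →₀ ℕ} (hμ : μ.degree ≤ N) (h : ∀ i, μ (Sum.inr i) < d) :
    MvPolynomial.monomial μ 1 ∈ reducible G d ε N := by
  let α : ι → Fin d := fun i => ⟨μ (Sum.inr i), h i⟩
  let ν : τ →₀ ℕ := Finsupp.equivFunOnFinite.symm fun j => μ (Sum.inl j)
  refine ⟨fun β => if β = α then MvPolynomial.monomial ν 1 else 0, fun β s hs => ?_, fun z _ => ?_⟩
  · beta_reduce at hs
    by_cases hβ : β = α
    · rw [if_pos hβ] at hs
      have := MvPolynomial.support_monomial_subset hs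
      rw [Finset.mem_singleton] at this
      rw [this, hβ]
      refine le_trans (le_of_eq ?_) hμ
      rw [Finsupp.degree_eq_sum, Finsupp.degree_eq_sum, Fintype.sum_sum_type]
      rfl
    · rw [if_neg hβ] at hs
      simp at hs
  · rw [Finset.sum_eq_single α (fun β _ hβ => by beta_reduce; rw [if_neg hβ]; simp) (by simp)]
    beta_reduce
    rw [if_pos rfl, MvPolynomial.aeval_monomial,
      MvPolynomial.aeval_monomial, Finsupp.prod_fintype _ _ (by simp),
      Finsupp.prod_fintype _ _ (by simp), Fintype.prod_sum_type]
    simp [ν, α]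

theorem smul_add_topReplace_mem_reducible (G : ι → MvPolynomial (τ ⊕ ι) ℂ) (d : ℕ) (ε : ℂ) (N : ℕ) :
    ∀ q ∈ MvPolynomial.restrictTotalDegree (τ ⊕ ι) ℂ N,
      ε • q + topReplace G d q ∈ reducible G d ε N := by
  refine mem_restrictTotalDegree_induction ((reducible G d ε N).comap
    (ε • (1 : Module.End ℂ (MvPolynomial (τ ⊕ ι) ℂ)) + topReplace G d)) fun μ hμ => ?_
  rw [Submodule.mem_comap, LinearMap.add_apply, LinearMap.smul_apply, Module.End.one_apply,
    topReplace_monomial]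
  split_ifs with h
  · convert! mul_mem_reducible G d ε N h.choose
      (MvPolynomial.monomial (μ - Finsupp.single (Sum.inr h.choose) d) 1) using 1
    rw [mul_add, add_comm, mul_smul_comm, MvPolynomial.X_pow_eq_monomial,
      MvPolynomial.monomial_mul, one_mul,
      tsub_add_cancel_of_le (Finsupp.single_le_iff.2 h.choose_spec)]
  · push Not at h
    rw [add_zero]
    exact Submodule.smul_mem _ _ (monomial_mem_reducible G d ε hμ h)

theorem eventually_mem_reducible {G : ι → MvPolynomial (τ ⊕ ι) ℂ} {d : ℕ}
    (hG : ∀ i, (G i).totalDegree ≤ d) (N : ℕ) :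
    ∀ᶠ ε in nhdsWithin (0 : ℂ) {0}ᶜ, ∀ h : MvPolynomial (τ ⊕ ι) ℂ, h.totalDegree ≤ N →
      h ∈ reducible G d ε N := by
  filter_upwards [eventually_exists_smul_add_topReplace_eq hG N] with ε hε h hh
  obtain ⟨q, hq, rfl⟩ := hε h ((MvPolynomial.mem_restrictTotalDegree _ _ _).2 hh)
  exact smul_add_topReplace_mem_reducible G d ε N q hq

/-- A determinant whose entries have degree at most `1 + deg (row) - deg (column)` has degree at
most the size of the matrix. -/
theorem totalDegree_det_le_card {σ κ : Type*} [Fintype κ] [DecidableEq κ]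
    (A : Matrix κ κ (MvPolynomial σ ℂ)) (δ : κ → ℕ)
    (hA : ∀ α β, A α β ≠ 0 → (A α β).totalDegree + δ β ≤ 1 + δ α) :
    A.det.totalDegree ≤ Fintype.card κ := by
  rw [Matrix.det_apply]
  refine MvPolynomial.totalDegree_finsetSum_le fun s _ => ?_
  refine (MvPolynomial.totalDegree_smul_le _ _).trans ?_
  by_cases h0 : ∃ α, A (s α) α = 0
  · obtain ⟨α, hα⟩ := h0
    have h1 : ∏ i, A (s i) i = 0 := Finset.prod_eq_zero (Finset.mem_univ α) hα
    rw [h1, MvPolynomial.totalDegree_zero]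
    exact Nat.zero_le _
  · push Not at h0
    refine (MvPolynomial.totalDegree_finsetProd _ _).trans ?_
    have h1 := Finset.sum_le_sum fun α (_ : α ∈ Finset.univ) => hA (s α) α (h0 α)
    rw [Finset.sum_add_distrib, Finset.sum_add_distrib, Equiv.sum_comp s δ] at h1
    simp only [Finset.sum_const, Finset.card_univ, smul_eq_mul, mul_one] at h1
    omega

/-- For all small nonzero `ε`, the linear form `u = ∑ aᵢ xᵢ` satisfies on the zeros of the
`Gᵢ + ε xᵢᵈ` an equation over `ℂ[y]` of total degree at most `d ^ n`: the characteristic equation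
of multiplication by `u` on the span of the `x^α` with all `αᵢ < d`. -/
theorem eventually_exists_charpoly {G : ι → MvPolynomial (τ ⊕ ι) ℂ} {d : ℕ}
    (hG : ∀ i, (G i).totalDegree ≤ d) (a : ι → ℂ) (hne : Nonempty (ι → Fin d)) :
    ∀ᶠ ε in nhdsWithin (0 : ℂ) {0}ᶜ, ∃ P : MvPolynomial (Option τ) ℂ, P ≠ 0 ∧
      P.totalDegree ≤ d ^ Fintype.card ι ∧
      ∀ z : τ ⊕ ι → ℂ, (∀ i, MvPolynomial.aeval z (G i) + ε * z (Sum.inr i) ^ d = 0) →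
        MvPolynomial.aeval (fun o : Option τ =>
          o.elim (∑ i, a i * z (Sum.inr i)) (z ∘ Sum.inl)) P = 0 := by
  classical
  have hev : ∀ᶠ ε in nhdsWithin (0 : ℂ) {0}ᶜ, ∀ α : ι → Fin d, ∀ h : MvPolynomial (τ ⊕ ι) ℂ,
      h.totalDegree ≤ 1 + ∑ i, (α i : ℕ) → h ∈ reducible G d ε (1 + ∑ i, (α i : ℕ)) :=
    Filter.eventually_all.2 fun α => eventually_mem_reducible hG _
  filter_upwards [hev] with ε hε
  let h : (ι → Fin d) → MvPolynomial (τ ⊕ ι) ℂ := fun α =>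
    (∑ i, MvPolynomial.C (a i) * MvPolynomial.X (Sum.inr i)) *
      ∏ i, MvPolynomial.X (Sum.inr i) ^ (α i : ℕ)
  have hdeg : ∀ α, (h α).totalDegree ≤ 1 + ∑ i, (α i : ℕ) := fun α => by
    refine (MvPolynomial.totalDegree_mul _ _).trans (add_le_add ?_ ?_)
    · refine MvPolynomial.totalDegree_finsetSum_le fun i _ => ?_
      refine (MvPolynomial.totalDegree_mul _ _).trans ?_
      simp
    · refine (MvPolynomial.totalDegree_finsetProd _ _).trans (Finset.sum_le_sum fun i _ => ?_)
      rw [MvPolynomial.totalDegree_X_pow]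
  choose M hM hMz using fun α => hε α (h α) (hdeg α)
  let A : Matrix (ι → Fin d) (ι → Fin d) (MvPolynomial (Option τ) ℂ) :=
    Matrix.diagonal (fun _ => MvPolynomial.X none) -
      Matrix.of fun α β => MvPolynomial.rename some (M α β)
  have hMdeg : ∀ α β, M α β ≠ 0 →
      (M α β).totalDegree + ∑ i, (β i : ℕ) ≤ 1 + ∑ i, (α i : ℕ) := fun α β h0 => by
    obtain ⟨s, hs, hsd⟩ := (M α β).support.exists_mem_eq_sup
      (MvPolynomial.support_nonempty.2 h0) (fun s => s.degree)
    have : (M α β).totalDegree = s.degree := hsd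
    rw [this]
    exact hM α β s hs
  refine ⟨A.det, ?_, ?_, fun z hz => ?_⟩
  · have hA : (MvPolynomial.optionEquivLeft ℂ τ) A.det = (Matrix.of M).charpoly := by
      rw [Matrix.charpoly, AlgEquiv.map_det]
      congr 1
      ext1 α β
      by_cases hαβ : α = β
      · subst hαβ
        simp [A, optionEquivLeft_rename_some, Matrix.charmatrix_apply_eq]
      · simp [A, optionEquivLeft_rename_some, hαβ, Matrix.charmatrix_apply_ne]
    intro h0
    rw [h0, map_zero] at hA
    exact (Matrix.charpoly_monic (Matrix.of M)).ne_zero hA.symm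
  · refine (totalDegree_det_le_card A (fun α => ∑ i, (α i : ℕ)) fun α β h0 => ?_).trans_eq
      (by simp)
    have hr := MvPolynomial.totalDegree_rename_le some (M α β)
    by_cases hαβ : α = β
    · subst hαβ
      have h1 : (A α α).totalDegree ≤ 1 := by
        simp only [A, Matrix.sub_apply, Matrix.diagonal_apply_eq, Matrix.of_apply]
        refine (MvPolynomial.totalDegree_sub _ _).trans (max_le (by simp) ?_)
        by_cases h2 : M α α = 0
        · simp [h2]
        · have := hMdeg α α h2
          omega
      omega
    · simp only [A, Matrix.sub_apply, Matrix.diagonal_apply_ne _ hαβ, Matrix.of_apply, zero_sub,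
        MvPolynomial.totalDegree_neg] at h0 ⊢
      have h2 : M α β ≠ 0 := by
        intro h2
        simp [h2] at h0
      have := hMdeg α β h2
      omega
  · let φ : MvPolynomial (Option τ) ℂ →ₐ[ℂ] ℂ := MvPolynomial.aeval (fun o : Option τ =>
      o.elim (∑ i, a i * z (Sum.inr i)) (z ∘ Sum.inl))
    change φ A.det = 0
    rw [AlgHom.map_det]
    refine Matrix.exists_mulVec_eq_zero_iff.1
      ⟨fun β => ∏ i, z (Sum.inr i) ^ (β i : ℕ), fun h0 => ?_, ?_⟩
    · -- the entry at the exponent `0` is `1`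
      obtain ⟨β⟩ := hne
      have := congrFun h0 fun i => ⟨0, (β i).pos⟩
      simp at this
    · ext α
      have h1 := hMz α z hz
      have hφ : ∀ β, φ (MvPolynomial.rename some (M α β)) =
          MvPolynomial.aeval (z ∘ Sum.inl) (M α β) := fun β => by
        simp only [φ, MvPolynomial.aeval_rename]
        rfl
      have hφX : φ (MvPolynomial.X none) = ∑ i, a i * z (Sum.inr i) := by
        simp [φ]
      simp only [h, map_mul, map_sum, map_prod, map_pow, MvPolynomial.aeval_X,
        MvPolynomial.aeval_C, Algebra.algebraMap_self, RingHom.id_apply] at h1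
      simp only [Matrix.mulVec, dotProduct, AlgHom.mapMatrix_apply, Matrix.map_apply, A,
        Matrix.sub_apply, Matrix.of_apply, map_sub, hφ, sub_mul, Finset.sum_sub_distrib,
        Pi.zero_apply]
      rw [← h1, sub_eq_zero, Finset.sum_eq_single α]
      · rw [Matrix.diagonal_apply_eq, hφX]
      · intro β _ hβ
        rw [Matrix.diagonal_apply_ne _ (Ne.symm hβ), map_zero, zero_mul]
      · simp

end Perturbation

/-! ### Nondegenerate zeros as limits -/

section Limit

open Topology Filter

variable {τ ι : Type*} [Fintype ι]

/-- The derivative in the direction `ξ` in the `x`-space of a polynomial in `(y, x)`, evaluated at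
a point. -/
def derivAlong {k K : Type*} [Field k] [Field K] [Algebra k K] (z : τ ⊕ ι → K) (ξ : ι → K)
    (p : MvPolynomial (τ ⊕ ι) k) : K :=
  ∑ i, MvPolynomial.aeval z (MvPolynomial.pderiv (Sum.inr i) p) * ξ i

theorem hasStrictFDerivAt_aeval_sumElim (p : MvPolynomial (τ ⊕ ι) ℂ) (η : τ → ℂ) (x : ι → ℂ) :
    ∃ L : (ι → ℂ) →L[ℂ] ℂ, (∀ ξ, L ξ = derivAlong (Sum.elim η x) ξ p) ∧
      HasStrictFDerivAt (fun x => MvPolynomial.aeval (Sum.elim η x) p) L x := by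
  classical
  induction p using MvPolynomial.induction_on with
  | C r =>
    refine ⟨0, fun ξ => by simp [derivAlong], ?_⟩
    simpa using hasStrictFDerivAt_const r x
  | add p q hp hq =>
    obtain ⟨L, hL, hp⟩ := hp
    obtain ⟨L', hL', hq⟩ := hq
    refine ⟨L + L', fun ξ => ?_, ?_⟩
    · simp [hL, hL', derivAlong, add_mul, Finset.sum_add_distrib]
    · simp only [map_add]
      exact hp.add hq
  | mul_X p o hp =>
    obtain ⟨L, hL, hp⟩ := hp
    cases o with
    | inl j =>
      refine ⟨η j • L, fun ξ => ?_, ?_⟩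
      · rw [_root_.smul_apply, hL, derivAlong, derivAlong, smul_eq_mul,
          Finset.mul_sum]
        refine Finset.sum_congr rfl fun i _ => ?_
        rw [MvPolynomial.pderiv_mul, MvPolynomial.pderiv_X_of_ne (by simp)]
        simp
        ring
      · simpa [mul_comm] using hp.const_mul (η j)
    | inr j =>
      refine ⟨MvPolynomial.aeval (Sum.elim η x) p • ContinuousLinearMap.proj j + x j • L,
        fun ξ => ?_, ?_⟩
      · simp only [_root_.add_apply, _root_.smul_apply, hL, derivAlong,
          ContinuousLinearMap.proj_apply, smul_eq_mul, MvPolynomial.pderiv_mul, map_add, map_mul,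
          MvPolynomial.aeval_X, Sum.elim_inr, MvPolynomial.pderiv_X, add_mul,
          Finset.sum_add_distrib]
        rw [add_comm, Finset.mul_sum]
        congr 1
        · refine Finset.sum_congr rfl fun i _ => ?_
          ring
        · rw [Finset.sum_eq_single j]
          · simp
          · intro i _ hi
            simp [hi.symm]
          · simp
      · simp only [map_mul, MvPolynomial.aeval_X, Sum.elim_inr]
        exact hp.mul (hasStrictFDerivAt_apply (𝕜 := ℂ) j x)

/-- A nondegenerate zero of a square system persists under the perturbation by `ε xᵢᵈ`, by the
inverse function theorem. -/
theorem eventually_exists_zero_mem {G : ι → MvPolynomial (τ ⊕ ι) ℂ} (d : ℕ) {η : τ → ℂ}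
    {x : ι → ℂ} (hx : ∀ i, MvPolynomial.aeval (Sum.elim η x) (G i) = 0)
    (hker : ∀ ξ, (∀ i, derivAlong (Sum.elim η x) ξ (G i) = 0) → ξ = 0) {U : Set (ι → ℂ)}
    (hU : U ∈ 𝓝 x) :
    ∀ᶠ ε in 𝓝 (0 : ℂ), ∃ x' ∈ U,
      ∀ i, MvPolynomial.aeval (Sum.elim η x') (G i) + ε * x' i ^ d = 0 := by
  choose L hL hGL using fun i => hasStrictFDerivAt_aeval_sumElim (G i) η x
  -- local surjectivity of `F` at `(x, 0)` gives preimages of the points `(0, ε)`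
  let F : (ι → ℂ) × ℂ → (ι → ℂ) × ℂ := fun p =>
    (fun i => MvPolynomial.aeval (Sum.elim η p.1) (G i) + p.2 * p.1 i ^ d, p.2)
  have hcomp : ∀ i, ∃ F' : ((ι → ℂ) × ℂ) →L[ℂ] ℂ,
      HasStrictFDerivAt (fun p : (ι → ℂ) × ℂ =>
        MvPolynomial.aeval (Sum.elim η p.1) (G i) + p.2 * p.1 i ^ d) F' (x, 0) ∧
      ∀ ξ : ι → ℂ, F' (ξ, 0) = L i ξ := fun i => by
    have h1 : HasStrictFDerivAt (fun p : (ι → ℂ) × ℂ => MvPolynomial.aeval (Sum.elim η p.1) (G i))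
        ((L i).comp (ContinuousLinearMap.fst ℂ (ι → ℂ) ℂ)) (x, 0) :=
      HasStrictFDerivAt.comp (f := Prod.fst) (x, (0 : ℂ)) (hGL i) hasStrictFDerivAt_fst
    let pr : ((ι → ℂ) × ℂ) →L[ℂ] ℂ :=
      (ContinuousLinearMap.proj (R := ℂ) (φ := fun _ : ι => ℂ) i).comp
        (ContinuousLinearMap.fst ℂ (ι → ℂ) ℂ)
    have h2 : HasStrictFDerivAt (fun p : (ι → ℂ) × ℂ => p.1 i) pr (x, 0) := pr.hasStrictFDerivAt
    have h3 := hasStrictFDerivAt_snd (𝕜 := ℂ) (p := (x, (0 : ℂ)))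
    exact ⟨_, h1.add (h3.mul (h2.pow d)), fun ξ => by simp⟩
  choose F' hF' hF'ξ using hcomp
  have hF : HasStrictFDerivAt F
      ((ContinuousLinearMap.pi F').prod (ContinuousLinearMap.snd ℂ (ι → ℂ) ℂ)) (x, 0) :=
    (hasStrictFDerivAt_pi.2 hF').prodMk hasStrictFDerivAt_snd
  have hsurj : ((ContinuousLinearMap.pi F').prod
      (ContinuousLinearMap.snd ℂ (ι → ℂ) ℂ)).range = ⊤ := by
    rw [LinearMap.range_eq_top]
    refine LinearMap.injective_iff_surjective.1 ?_
    rw [← LinearMap.ker_eq_bot, LinearMap.ker_eq_bot']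
    rintro ⟨ξ, ε⟩ h
    have h2 : ε = 0 := congrArg Prod.snd h
    subst h2
    have h1 : ∀ i, F' i (ξ, 0) = 0 := fun i => congrFun (congrArg Prod.fst h) i
    rw [hker ξ fun i => by rw [← hL, ← hF'ξ, h1]]
    rfl
  have hmap := hF.map_nhds_eq_of_surj hsurj
  have hF0 : F (x, 0) = (0, 0) := by
    refine Prod.ext (funext fun i => ?_) rfl
    simp [F, hx]
  have hmem : F '' (U ×ˢ Set.univ) ∈ 𝓝 ((0 : ι → ℂ), (0 : ℂ)) := by
    rw [← hF0, ← hmap]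
    exact image_mem_map (prod_mem_nhds hU univ_mem)
  have hcont : Tendsto (fun ε : ℂ => ((0 : ι → ℂ), ε)) (𝓝 0) (𝓝 (0, 0)) :=
    (Continuous.prodMk_right _).tendsto 0
  filter_upwards [hcont hmem] with ε hε
  obtain ⟨⟨x', ε'⟩, ⟨hx', -⟩, h⟩ := hε
  have h2 : ε' = ε := congrArg Prod.snd h
  subst h2
  exact ⟨x', hx', fun i => congrFun (congrArg Prod.fst h) i⟩

/-- The polynomial with coefficients `c`. -/
def ofCoeffs {σ : Type*} (S : Finset (σ →₀ ℕ)) (c : S → ℂ) : MvPolynomial σ ℂ :=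
  ∑ s : S, MvPolynomial.monomial s.1 (c s)

theorem coeff_ofCoeffs {σ : Type*} (S : Finset (σ →₀ ℕ)) (c : S → ℂ) (s : S) :
    (ofCoeffs S c).coeff s.1 = c s := by
  classical
  rw [ofCoeffs, MvPolynomial.coeff_sum, Finset.sum_eq_single s]
  · simp
  · intro r _ hr
    rw [MvPolynomial.coeff_monomial, if_neg fun h => hr (Subtype.ext h)]
  · simp

theorem ofCoeffs_coeff {σ : Type*} {S : Finset (σ →₀ ℕ)} {P : MvPolynomial σ ℂ}
    (hP : P.support ⊆ S) : ofCoeffs S (fun s => P.coeff s.1) = P := by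
  conv_rhs => rw [P.as_sum]
  rw [ofCoeffs, Finset.sum_coe_sort S (fun s => MvPolynomial.monomial s (P.coeff s))]
  refine (Finset.sum_subset hP fun s _ hs => ?_).symm
  rw [MvPolynomial.notMem_support_iff.1 hs, map_zero]

theorem continuous_aeval_ofCoeffs {σ : Type*} (S : Finset (σ →₀ ℕ)) :
    Continuous fun p : (S → ℂ) × (σ → ℂ) => MvPolynomial.aeval p.2 (ofCoeffs S p.1) := by
  simp only [ofCoeffs, map_sum, MvPolynomial.aeval_monomial, Finsupp.prod,
    Algebra.algebraMap_self, RingHom.id_apply]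
  fun_prop

/-- The linear form `u = ∑ aᵢ xᵢ` satisfies an equation over `ℂ[y]` of total degree at most `d ^ n`
on the nondegenerate zeros of `n` polynomials in `(y, x₁, …, xₙ)` of degree at most `d`. It is a
limit of normalized characteristic equations for the perturbed systems. -/
theorem exists_equation_of_nondegenerate [Fintype τ] [DecidableEq ι]
    {G : ι → MvPolynomial (τ ⊕ ι) ℂ} {d : ℕ} (hG : ∀ i, (G i).totalDegree ≤ d) (a : ι → ℂ)
    (hne : Nonempty (ι → Fin d)) :
    ∃ P : MvPolynomial (Option τ) ℂ, P ≠ 0 ∧ P.totalDegree ≤ d ^ Fintype.card ι ∧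
      ∀ (η : τ → ℂ) (x : ι → ℂ), (∀ i, MvPolynomial.aeval (Sum.elim η x) (G i) = 0) →
        (∀ ξ, (∀ i, derivAlong (Sum.elim η x) ξ (G i) = 0) → ξ = 0) →
        MvPolynomial.aeval (fun o : Option τ => o.elim (∑ i, a i * x i) η) P = 0 := by
  set B := d ^ Fintype.card ι
  let S : Finset (Option τ →₀ ℕ) := (Finsupp.finite_of_degree_le (σ := Option τ) B).toFinset
  have hmem : ∀ s, s ∈ S ↔ s.degree ≤ B := fun s => Set.Finite.mem_toFinset _
  have hS : ∀ P : MvPolynomial (Option τ) ℂ, P.totalDegree ≤ B → P.support ⊆ S :=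
    fun P hP s hs => (hmem s).2 ((MvPolynomial.le_totalDegree hs).trans hP)
  have hdeg : ∀ c : S → ℂ, (ofCoeffs S c).totalDegree ≤ B := fun c => by
    refine MvPolynomial.totalDegree_finsetSum_le fun s _ => ?_
    exact (MvPolynomial.totalDegree_monomial_le _ _).trans ((hmem s.1).1 s.2)
  have hsmul : ∀ (r : ℂ) (c : S → ℂ), ofCoeffs S (r • c) = r • ofCoeffs S c := fun r c => by
    simp [ofCoeffs, Finset.smul_sum, MvPolynomial.smul_monomial]
  have hev : ∀ᶠ ε in 𝓝[≠] (0 : ℂ), ∃ c : S → ℂ, c ∈ Metric.sphere (0 : S → ℂ) 1 ∧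
      ∀ z : τ ⊕ ι → ℂ, (∀ i, MvPolynomial.aeval z (G i) + ε * z (Sum.inr i) ^ d = 0) →
        MvPolynomial.aeval (fun o : Option τ =>
          o.elim (∑ i, a i * z (Sum.inr i)) (z ∘ Sum.inl)) (ofCoeffs S c) = 0 := by
    filter_upwards [eventually_exists_charpoly hG a hne] with ε hε
    obtain ⟨P, hP0, hPdeg, hP⟩ := hε
    let c : S → ℂ := fun s => P.coeff s.1
    have hc : ofCoeffs S c = P := ofCoeffs_coeff (hS P hPdeg)
    have hc0 : c ≠ 0 := by
      rintro h
      apply hP0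
      rw [← hc, h]
      simp [ofCoeffs]
    refine ⟨((‖c‖⁻¹ : ℝ) : ℂ) • c, ?_, fun z hz => ?_⟩
    · rw [mem_sphere_zero_iff_norm, norm_smul, Complex.norm_real, norm_inv, norm_norm,
        inv_mul_cancel₀ (norm_ne_zero_iff.2 hc0)]
    · rw [hsmul, hc, map_smul, hP z hz, smul_zero]
  obtain ⟨c, hc⟩ := hev.choice
  obtain ⟨c₀, hc₀, hcl⟩ := (isCompact_sphere (0 : S → ℂ) 1).exists_mapClusterPt
    (f := 𝓝[≠] (0 : ℂ)) (u := c) (by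
      rw [le_principal_iff, mem_map]
      filter_upwards [hc] with ε hε using hε.1)
  refine ⟨ofCoeffs S c₀, ?_, hdeg c₀, fun η x hx hker => ?_⟩
  · intro h0
    have : c₀ = 0 := funext fun s => by rw [← coeff_ofCoeffs S c₀ s, h0]; simp
    rw [this] at hc₀
    simp at hc₀
  · by_contra hne0
    -- if the limit equation failed at `x`, so would those for nearby coefficients and points
    let e : (S → ℂ) × (ι → ℂ) → ℂ := fun p => MvPolynomial.aeval
      (fun o : Option τ => o.elim (∑ i, a i * p.2 i) η) (ofCoeffs S p.1)
    have he : Continuous e := by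
      refine (continuous_aeval_ofCoeffs S).comp (f := fun p : (S → ℂ) × (ι → ℂ) =>
        (p.1, fun o : Option τ => o.elim (∑ i, a i * p.2 i) η)) ?_
      refine continuous_fst.prodMk (continuous_pi fun o => ?_)
      cases o with
      | none => exact continuous_finsetSum _ fun i _ => by fun_prop
      | some j => exact continuous_const
    have hopen : {p | e p ≠ 0} ∈ 𝓝 (c₀, x) := (isOpen_ne_fun he continuous_const).mem_nhds hne0
    rw [nhds_prod_eq, mem_prod_iff] at hopen
    obtain ⟨W, hW, U, hU, hWU⟩ := hopen
    have h1 := mapClusterPt_iff_frequently.1 hcl W hW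
    have h2 := (eventually_exists_zero_mem d hx hker hU).filter_mono
      (nhdsWithin_le_nhds (s := {0}ᶜ))
    obtain ⟨ε, hεW, ⟨x', hx'U, hx'⟩, hε⟩ := (h1.and_eventually (h2.and hc)).exists
    exact hWU (Set.mk_mem_prod hεW hx'U) (hε.2 (Sum.elim η x') hx')

/-- A countable family of matrices with trivial kernel can be made invertible by multiplication with
one matrix from the left: for each member this holds on a dense open set. -/
theorem exists_forall_det_mul_ne_zero {κ κ' : Type*} [Fintype κ] [Fintype κ'] [DecidableEq κ']
    {T : Set (Matrix κ κ' ℂ)} (hT : T.Countable)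
    (hker : ∀ J ∈ T, ∀ ξ, J.mulVec ξ = 0 → ξ = 0) :
    ∃ Λ : Matrix κ' κ ℂ, ∀ J ∈ T, (Λ * J).det ≠ 0 := by
  classical
  have : BaireSpace (Matrix κ' κ ℂ) := inferInstanceAs (BaireSpace (κ' → κ → ℂ))
  have hopen : ∀ J ∈ T, IsOpen {Λ : Matrix κ' κ ℂ | (Λ * J).det ≠ 0} := fun J _ =>
    isOpen_ne_fun (Continuous.matrix_det (Continuous.matrix_mul continuous_id continuous_const))
      continuous_const
  have hdense : ∀ J ∈ T, Dense {Λ : Matrix κ' κ ℂ | (Λ * J).det ≠ 0} := by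
    intro J hJ Λ
    have hinj : LinearMap.ker (Matrix.toLin' J) = ⊥ := LinearMap.ker_eq_bot'.2 (hker J hJ)
    obtain ⟨g, hg⟩ := LinearMap.exists_leftInverse_of_injective (Matrix.toLin' J) hinj
    let Λ₀ : Matrix κ' κ ℂ := LinearMap.toMatrix' g
    have hΛ₀ : Λ₀ * J = 1 := by
      rw [← LinearMap.toMatrix'_toLin' J, ← LinearMap.toMatrix'_comp, hg,
        LinearMap.toMatrix'_id]
    -- `det ((Λ + s Λ₀) J)` is the characteristic polynomial of `-Λ J` at `s`
    have hev : ∀ᶠ s in 𝓝[≠] (0 : ℂ), ((Λ + s • Λ₀) * J).det ≠ 0 := by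
      have hfin : {s : ℂ | (-(Λ * J)).charpoly.eval s = 0}.Finite :=
        finite_setOf_eval_eq_zero (Matrix.charpoly_monic _).ne_zero
      filter_upwards [nhdsNE_le_cofinite 0 hfin.eventually_cofinite_notMem] with s hs
      change ¬ (-(Λ * J)).charpoly.eval s = 0 at hs
      rw [Matrix.eval_charpoly, sub_neg_eq_add] at hs
      have : (Λ + s • Λ₀) * J = Matrix.scalar κ' s + Λ * J := by
        rw [Matrix.add_mul, Matrix.smul_mul, hΛ₀, add_comm, Matrix.smul_one_eq_diagonal]
        rfl
      rwa [this]
    have hlim : Tendsto (fun s : ℂ => Λ + s • Λ₀) (𝓝[≠] 0) (𝓝 Λ) := by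
      have : Continuous fun s : ℂ => Λ + s • Λ₀ :=
        continuous_const.add (continuous_id.smul continuous_const)
      have h := this.tendsto 0
      rw [zero_smul, add_zero] at h
      exact h.mono_left nhdsWithin_le_nhds
    exact mem_closure_of_tendsto hlim hev
  obtain ⟨Λ, hΛ⟩ := (dense_biInter_of_isOpen hopen hT hdense).nonempty
  exact ⟨Λ, fun J hJ => Set.mem_iInter₂.1 hΛ J hJ⟩

end Limit

/-! ### The Bézout bound -/

section

variable {t n m : ℕ}

section Jacobian

variable {f : Fin m → MvPolynomial (Fin t ⊕ Fin n) ℚ} {a : Fin n → ℚ}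
  {w : MvPolynomial (Option (Fin t)) ℚ} {E : MvPolynomial (Fin t) ℚ}
  {V : Fin n → (MvPolynomial (Fin t) ℚ)[X]} {K : Type*} [Field K] [Algebra ℚ K]

theorem derivAlong_add (z : Fin t ⊕ Fin n → K) (ξ : Fin n → K)
    (p q : MvPolynomial (Fin t ⊕ Fin n) ℚ) :
    derivAlong z ξ (p + q) = derivAlong z ξ p + derivAlong z ξ q := by
  simp [derivAlong, add_mul, Finset.sum_add_distrib]

theorem derivAlong_sub (z : Fin t ⊕ Fin n → K) (ξ : Fin n → K)
    (p q : MvPolynomial (Fin t ⊕ Fin n) ℚ) :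
    derivAlong z ξ (p - q) = derivAlong z ξ p - derivAlong z ξ q := by
  simp [derivAlong, sub_mul, Finset.sum_sub_distrib]

theorem derivAlong_mul (z : Fin t ⊕ Fin n → K) (ξ : Fin n → K)
    (p q : MvPolynomial (Fin t ⊕ Fin n) ℚ) :
    derivAlong z ξ (p * q) = derivAlong z ξ p * MvPolynomial.aeval z q +
      MvPolynomial.aeval z p * derivAlong z ξ q := by
  simp only [derivAlong, MvPolynomial.pderiv_mul, map_add, map_mul, Finset.sum_mul, Finset.mul_sum,
    ← Finset.sum_add_distrib]
  refine Finset.sum_congr rfl fun i _ => ?_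
  ring

theorem derivAlong_X_inr (z : Fin t ⊕ Fin n → K) (ξ : Fin n → K) (i : Fin n) :
    derivAlong z ξ (MvPolynomial.X (Sum.inr i) : MvPolynomial (Fin t ⊕ Fin n) ℚ) = ξ i := by
  rw [derivAlong, Finset.sum_eq_single i]
  · simp
  · intro j _ hj
    rw [MvPolynomial.pderiv_X_of_ne (by simpa using hj.symm)]
    simp
  · simp

theorem derivAlong_eq_zero_of_mem_span {z : Fin t ⊕ Fin n → K} {ξ : Fin n → K}
    (hz : ∀ j, MvPolynomial.aeval z (f j) = 0) (hξ : ∀ j, derivAlong z ξ (f j) = 0)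
    {h : MvPolynomial (Fin t ⊕ Fin n) ℚ} (hh : h ∈ Ideal.span (Set.range f)) :
    derivAlong z ξ h = 0 := by
  induction hh using Submodule.span_induction with
  | mem p hp =>
    obtain ⟨j, rfl⟩ := hp
    exact hξ j
  | zero => simp [derivAlong]
  | add p q _ _ hp hq => rw [derivAlong_add, hp, hq, add_zero]
  | smul r p hp ih =>
    rw [smul_eq_mul, derivAlong_mul, ih, aeval_eq_zero_of_mem_span hz hp, mul_zero, mul_zero,
      add_zero]

theorem pderiv_rename_inl (i : Fin n) (c : MvPolynomial (Fin t) ℚ) :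
    MvPolynomial.pderiv (Sum.inr i : Fin t ⊕ Fin n) (MvPolynomial.rename Sum.inl c) = 0 := by
  classical
  refine MvPolynomial.pderiv_eq_zero_of_notMem_vars fun h => ?_
  have := MvPolynomial.vars_rename _ _ h
  simp at this

theorem pderiv_linForm (i : Fin n) :
    MvPolynomial.pderiv (Sum.inr i : Fin t ⊕ Fin n) (linForm t a) = MvPolynomial.C (a i) := by
  classical
  rw [linForm, map_sum, Finset.sum_eq_single i]
  · simp
  · intro j _ hj
    rw [MvPolynomial.pderiv_C_mul, MvPolynomial.pderiv_X_of_ne (by simpa using hj), mul_zero]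
  · simp

theorem pderiv_substU (i : Fin n) (p : (MvPolynomial (Fin t) ℚ)[X]) :
    MvPolynomial.pderiv (Sum.inr i) (substU a p) =
      substU a (derivative p) * MvPolynomial.C (a i) := by
  induction p using Polynomial.induction_on' with
  | add p q hp hq => rw [map_add, map_add, hp, hq, derivative_add, map_add, add_mul]
  | monomial k c =>
    rw [derivative_monomial]
    simp only [substU, coe_eval₂RingHom, eval₂_monomial, MvPolynomial.pderiv_mul,
      MvPolynomial.pderiv_pow, pderiv_linForm]
    have h := pderiv_rename_inl (n := n) i c
    simp only [AlgHom.toRingHom_eq_coe, RingHom.coe_coe, map_mul, map_natCast, h]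
    ring

theorem derivAlong_substU (η : Fin t → K) (x ξ : Fin n → K) (p : (MvPolynomial (Fin t) ℚ)[X]) :
    derivAlong (Sum.elim η x) ξ (substU a p) =
      (specialize η (derivative p)).eval (linVal a x) * linVal a ξ := by
  simp only [derivAlong, pderiv_substU, map_mul, aeval_substU, linVal, Finset.mul_sum]
  refine Finset.sum_congr rfl fun i _ => ?_
  simp [mul_assoc]

/-- Over good parameters the Jacobian matrix of the system with respect to `x` has trivial kernel.
A vector `ξ` in the kernel is annihilated by the differentials of all members of the ideal; that of
`w(y, u(x))` gives `u(ξ) = 0`, and those of `E w' xᵢ - Vᵢ` then give `ξᵢ = 0`. -/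
theorem IsClearedResolution.eq_zero_of_derivAlong (hc : IsClearedResolution f a w E V)
    {η : Fin t → K} (hη : IsGood w E η) {x ξ : Fin n → K} (hx : x ∈ solutions K f η)
    (hξ : ∀ j, derivAlong (Sum.elim η x) ξ (f j) = 0) : ξ = 0 := by
  have hroot := hc.eval_linVal hx
  have hlin : linVal a ξ = 0 := by
    have h := derivAlong_eq_zero_of_mem_span hx hξ hc.elim_mem
    rw [derivAlong_substU] at h
    exact (mul_eq_zero.1 h).resolve_left
      (eval_specialize_derivative_ne_zero hη.leadingCoeff hη.resultant hroot)
  ext i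
  have h := derivAlong_eq_zero_of_mem_span hx hξ (hc.param_mem i)
  rw [derivAlong_sub, derivAlong_mul, derivAlong_substU, derivAlong_substU, hlin, mul_zero,
    zero_mul, mul_zero, zero_add, sub_zero, aeval_substU, derivAlong_X_inr] at h
  exact (mul_eq_zero.1 h).resolve_left (hη.eval_denom_ne_zero hroot)

end Jacobian

theorem totalDegree_map_complex {σ : Type*} (p : MvPolynomial σ ℚ) :
    (MvPolynomial.map (algebraMap ℚ ℂ) p).totalDegree = p.totalDegree := by
  rw [MvPolynomial.totalDegree, MvPolynomial.totalDegree,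
    MvPolynomial.support_map_of_injective _ (algebraMap ℚ ℂ).injective]

/-- The rational good parameters. Countability makes the choice of one set of linear combinations
for all of them possible. -/
theorem exists_countable_isZariskiDense_isGood {w : MvPolynomial (Option (Fin t)) ℚ}
    (hs : Squarefree w) (hp : (inU w).IsPrimitive) {E : MvPolynomial (Fin t) ℚ} (hE : E ≠ 0) :
    ∃ S : Set (Fin t → ℂ), S.Countable ∧ IsZariskiDense S ∧ ∀ η ∈ S, IsGood w E η := by
  obtain ⟨D, hD, hDgood⟩ := exists_isGood_iff hs hp hE
  exact ⟨_, (Set.countable_range _).mono (Set.sep_subset _ _),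
    (isZariskiDense_rational (Fin t)).inter_ne_zero hD, fun η h => (hDgood η).2 h.2⟩

/-- The Bézout bound. Suitable linear combinations `Gᵢ` of the `fⱼ` have nondegenerate zeros at the
solutions over a countable Zariski dense set of parameters; there the equation of degree at most
`d ^ n` satisfied by `u` vanishes, so that it is a multiple of `w`. -/
theorem IsClearedResolution.totalDegree_le {f : Fin m → MvPolynomial (Fin t ⊕ Fin n) ℚ}
    {a : Fin n → ℚ} {w : MvPolynomial (Option (Fin t)) ℚ} {E : MvPolynomial (Fin t) ℚ}
    {V : Fin n → (MvPolynomial (Fin t) ℚ)[X]} (hc : IsClearedResolution f a w E V)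
    (hs : Squarefree w) (hp : (inU w).IsPrimitive) {d : ℕ} (hd : ∀ j, (f j).totalDegree ≤ d) :
    w.totalDegree ≤ d ^ n := by
  obtain ⟨S, hScount, hSdense, hSgood⟩ := exists_countable_isZariskiDense_isGood hs hp hc.ne_zero
  suffices h : ∃ P : MvPolynomial (Option (Fin t)) ℂ, P ≠ 0 ∧ P.totalDegree ≤ d ^ n ∧
      ∀ η ∈ S, ∀ x ∈ solutions ℂ f η, MvPolynomial.aeval (pointYU η (linVal a x)) P = 0 by
    obtain ⟨P, hP0, hPdeg, hP⟩ := h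
    obtain ⟨q, hq⟩ := map_dvd_of_forall_aeval_eq_zero hp hSdense
      (fun η h => (hSgood η h).leadingCoeff) (fun η h => (hSgood η h).resultant) (g := P)
      fun η h ϑ hϑ => by
        obtain ⟨x, hx, rfl⟩ := hc.exists_solution (hSgood η h) hϑ
        exact hP η h x hx
    have hq0 : q ≠ 0 := by rintro rfl; exact hP0 (by rw [hq, mul_zero])
    rw [hq, MvPolynomial.totalDegree_mul_of_isDomain (map_complex_ne_zero hs.ne_zero) hq0,
      totalDegree_map_complex] at hPdeg
    omega
  let J : (Fin t → ℂ) × (Fin n → ℂ) → Matrix (Fin m) (Fin n) ℂ := fun z => Matrix.of fun j k =>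
    MvPolynomial.aeval (Sum.elim z.1 z.2) (MvPolynomial.pderiv (Sum.inr k) (f j))
  have hJ : ∀ z ξ j, (J z).mulVec ξ j = derivAlong (Sum.elim z.1 z.2) ξ (f j) := fun z ξ j => rfl
  let T : Set ((Fin t → ℂ) × (Fin n → ℂ)) := {z | z.1 ∈ S ∧ z.2 ∈ solutions ℂ f z.1}
  have hT : T.Countable := by
    refine (hScount.biUnion fun η hη =>
      ((hc.finite_solutions (hSgood η hη)).countable.image (Prod.mk η))).mono ?_
    rintro ⟨η, x⟩ ⟨h1, h2⟩
    exact Set.mem_biUnion h1 ⟨x, h2, rfl⟩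
  have hker : ∀ z ∈ T, ∀ ξ, (J z).mulVec ξ = 0 → ξ = 0 := fun z hz ξ hξ =>
    hc.eq_zero_of_derivAlong (hSgood _ hz.1) hz.2 fun j => by rw [← hJ, hξ]; rfl
  obtain ⟨Λ, hΛ⟩ := exists_forall_det_mul_ne_zero (hT.image J)
    (by rintro _ ⟨z, hz, rfl⟩; exact hker z hz)
  let G : Fin n → MvPolynomial (Fin t ⊕ Fin n) ℂ := fun i =>
    ∑ j, MvPolynomial.C (Λ i j) * MvPolynomial.map (algebraMap ℚ ℂ) (f j)
  have hGdeg : ∀ i, (G i).totalDegree ≤ d := fun i => by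
    refine MvPolynomial.totalDegree_finsetSum_le fun j _ => ?_
    refine (MvPolynomial.totalDegree_mul _ _).trans ?_
    rw [MvPolynomial.totalDegree_C, zero_add,
      totalDegree_map_complex]
    exact hd j
  have hGderiv : ∀ z ξ i, derivAlong (Sum.elim z.1 z.2) ξ (G i) = ((Λ * J z).mulVec ξ) i := by
    intro z ξ i
    simp only [derivAlong, G, map_sum, MvPolynomial.pderiv_C_mul, MvPolynomial.pderiv_map, map_mul,
      aeval_map_complex, Matrix.mulVec, dotProduct, Matrix.mul_apply]
    refine Finset.sum_congr rfl fun k _ => ?_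
    simp [J]
  rcases isEmpty_or_nonempty (Fin n → Fin d) with hemp | hne
  · -- here `d = 0 < n`: the Jacobian matrix vanishes, so that there are no solutions
    refine ⟨1, one_ne_zero, by simp, fun η hη x hx => ?_⟩
    exfalso
    rw [← not_nonempty_iff] at hemp
    have hn : Nonempty (Fin n) := by
      by_contra h
      rw [not_nonempty_iff] at h
      exact hemp inferInstance
    have hd0 : d = 0 := by
      by_contra h
      exact hemp ⟨fun _ => ⟨0, Nat.pos_of_ne_zero h⟩⟩
    have h1 := hker (η, x) ⟨hη, hx⟩ 1 (by
      ext j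
      rw [hJ, derivAlong]
      refine Finset.sum_eq_zero fun k _ => ?_
      have hfj : (f j).totalDegree = 0 := Nat.le_zero.1 (hd0 ▸ hd j)
      rw [MvPolynomial.totalDegree_eq_zero_iff_eq_C.1 hfj]
      simp)
    obtain ⟨i⟩ := hn
    exact one_ne_zero (congrFun h1 i)
  · obtain ⟨P, hP0, hPdeg, hP⟩ := exists_equation_of_nondegenerate hGdeg (fun i => (a i : ℂ)) hne
    rw [Fintype.card_fin] at hPdeg
    refine ⟨P, hP0, hPdeg, fun η hη x hx => ?_⟩
    have := hP η x (fun i => ?_) fun ξ hξ => ?_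
    · exact this
    · simp only [G, map_sum, map_mul, aeval_map_complex]
      refine Finset.sum_eq_zero fun j _ => ?_
      rw [hx j, mul_zero]
    · refine Matrix.eq_zero_of_mulVec_eq_zero (hΛ _ ⟨(η, x), ⟨hη, hx⟩, rfl⟩) ?_
      ext i
      rw [← hGderiv (η, x), hξ i]
      rfl

end

end ParamSystem

end

theorem mainTheorem11 {t n m : ℕ} (f : Fin m → MvPolynomial (Fin t ⊕ Fin n) ℚ)
    (hf : ParamSystem.AssumptionB f) (d : ℕ) (hd : ∀ j, (f j).totalDegree ≤ d)
    (a : Fin n → ℚ) (w : MvPolynomial (Option (Fin t)) ℚ)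
    (v : Fin n → Polynomial (ParamSystem.RatFun t))
    (hw : ParamSystem.IsParametricResolution f a w v) :
    (ParamSystem.goodSet w v).Nonempty ∧
    (∀ η : Fin t → ℝ, (fun i => (η i : ℂ)) ∈ ParamSystem.goodSet w v →
      (ParamSystem.solutions ℝ f η).Finite ∧
      (ParamSystem.solutions ℝ f η).encard =
        {ϑ : ℝ | (ParamSystem.specialize η (ParamSystem.inU w)).eval ϑ = 0}.encard) ∧
    MvPolynomial.zeroLocus ℂ (ParamSystem.elimIdeal f a) =
      MvPolynomial.zeroLocus ℂ (Ideal.span {w}) ∧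
    ParamSystem.zariskiClosure
        (ParamSystem.projU '' MvPolynomial.zeroLocus ℂ (ParamSystem.idealU f a)) =
      MvPolynomial.zeroLocus ℂ (Ideal.span {w}) ∧
    w.totalDegree ≤ d ^ n := by
  obtain ⟨E, V, hE, hEη, hV⟩ := ParamSystem.exists_cleared v
  have hc := hw.isClearedResolution hf hE hEη hV
  have hgood : ∀ η, η ∈ ParamSystem.goodSet w v ↔ ParamSystem.IsGood w E η := fun η =>
    ⟨fun h => ⟨h.1, h.2.1, (hEη η).1 h.2.2⟩, fun h => ⟨h.1, h.2, (hEη η).2 h.3⟩⟩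
  have h1 := ParamSystem.zeroLocus_elimIdeal_subset hc.mem_elimIdeal
  have h2 := ParamSystem.zariskiClosure_projU_subset (f := f) (a := a)
  have h3 := hc.zeroLocus_subset_closure hw.squarefree hw.primitive
  refine ⟨?_, fun η hη => ?_, subset_antisymm h1 (h3.trans h2), subset_antisymm (h2.trans h1) h3,
    hc.totalDegree_le hw.squarefree hw.primitive hd⟩
  · obtain ⟨S, -, hS, hSgood⟩ :=
      ParamSystem.exists_countable_isZariskiDense_isGood hw.squarefree hw.primitive hE
    obtain ⟨η, hη⟩ := hS.nonempty
    exact ⟨η, (hgood η).2 (hSgood η hη)⟩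
  · have hη' : ParamSystem.IsGood w E η :=
      (ParamSystem.isGood_algHom_comp_iff (IsScalarTower.toAlgHom ℚ ℝ ℂ)).1 ((hgood _).1 hη)
    exact ⟨hc.finite_solutions hη', hc.encard_real_solutions hη'⟩
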